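/- **Setting.** Let $n\ge 1$ nodes be divided by $c:\{1,\dots,n\}\to\{1,\dots,k\}$ into $k$ communities of equal size $n/k$. For every unordered pair of distinct nodes $i,j$ the event times between $i$ and $j$ form a Hawkes process on $(0,\infty)$ with empty history at time $0$ and conditional intensity $\lambda(t)=\mu+\sum_{t_l<t}\alpha e^{-\beta(t-t_l)}$, independently over the pairs, with $(\mu,\alpha,\beta)=(\mu_1,\alpha_1,\beta_1)$ if $c_i=c_j$ and $(\mu,\alpha,\beta)=(\mu_2,\alpha_2,\beta_2)$ otherwise, where $\mu_i>0$, $0<\alpha_i<\beta_i$ and $\mu_1\neq\mu_2$. With $m_i=\alpha_i/\beta_i$, $\nu_i=\mu_i/(1-m_i)$, $\sigma_i^2=\mu_i/(1-m_i)^3$ assume $\nu_2<\nu_1\le K\nu_2$ and $K^{-1}\sigma_2\le\sigma_1\le K\sigma_2$ for a constant $K$. For $T>0$ let $A$ be the symmetric binary matrix with $A_{ij}=1$ if and only if $i\ne j$ and there is an event between $i$ and $j$ up to time $T$. Spectral clustering returns the labels $\hat c$ of any $(1+\epsilon)$-approximate solution, $\epsilon>0$, of the $k$-means problem for the rows of a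 matrix of $k$ orthonormal eigenvectors of $A$ that belong to the $k$ eigenvalues of largest absolute value, and $r_1=\min_\Pi\frac1n\sum_i 1(c_i\ne\Pi(\hat c_i))$, over the permutations $\Pi$ of the labels, is its error. Write $p_{ab}=1-e^{-\mu_{ab}T}$ with $\mu_{aa}=\mu_1$ and $\mu_{ab}=\mu_2$ for $a\ne b$, and let $E[A]$ denote the $n\times n$ matrix with entries $p_{c_ic_j}$ (also on the diagonal). **Claim.** For all $c_0,\rho,\epsilon,K>0$ there is a constant $C>0$, depending on nothing else, with the following properties (1) and (2). (1) If $n\,(1-e^{-\max(\mu_1,\mu_2)T})\ge c_0\log n$, then with probability at least $1-n^{-\rho}$ every output of spectral clustering on $A$ satisfies $$r_1\le C\,\frac{k^2}{n}\,\frac{1-e^{-\mu_1T}}{(e^{-\mu_2T}-e^{-\mu_1T})^2}.$$ (2) If all quantities vary along a sequence (or filter), always subject to the assumptions above including that of (1), such that $\mu_1T\to0$ and $\mu_2T\to0$, then eventually, with probability at least $1-n^{-\rho}$, every output satisfies $$r_1\le C\,\frac{nT\mu_1}{(n/k)^2(\mu_1-\mu_2)^2T^2},$$ and $$\frac{k^2}{n}\,\frac{1-e^{-\mu_1T}}{(e^{-\mu_2T}-e^{-\mu_1T})^2}\asymp\frac{nT\mu_1}{(n/k)^2(\mu_1-\mu_2)^2T^2}\asymp\frac{k^2}{nT}\,\frac{\mu_1}{(\mu_1-\mu_2)^2}.$$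 (3) Fix $n$, $k\ge2$, a division into $k$ equal communities, and constants $\epsilon,C',c_0>0$. If $\mu_1,\mu_2>0$, $\mu_1\ne\mu_2$ and $T>0$ vary such that $\mu_1T\to\infty$ and $\mu_2T\to\infty$, then the general upper bound for the error of spectral clustering on $A$, $$B=64(2+\epsilon)\,\frac{|a|_{\max}\,k\,C'\Delta}{n\,\lambda_{\min}(E[A])^2},\qquad \Delta=\max\{n\max_{i,j}E[A]_{ij},\,c_0\log n\},$$ where $|a|_{\max}$ is the size of the largest community and $\lambda_{\min}$ the minimum absolute value of a non-zero eigenvalue, tends to $\infty$; so the resulting bound $\min\{1,B\}$ for the error rate tends to $1$. -/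

import Mathlib

open MeasureTheory ProbabilityTheory Filter Topology Asymptotics

universe u v

noncomputable section

namespace CHIP

/-! ### Exponential Hawkes processes, given by their event times -/

/-- Conditional intensity at time `s`, given the first `l` event times `t 0, …, t (l - 1)`:
`μ + ∑ α exp (-β (s - t j))`, the sum being over those `j < l` with `t j < s`. -/
def hawkesIntensity (μ α β : ℝ) (t : ℕ → ℝ) (l : ℕ) (s : ℝ) : ℝ :=
  μ + ∑ j ∈ (Finset.range l).filter (fun j => t j < s), α * Real.exp (-β * (s - t j))

/-- Time of the last event before the event number `l` (the start time `0` if `l = 0`). -/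
def prevTime (t : ℕ → ℝ) : ℕ → ℝ
  | 0 => 0
  | l + 1 => t l

/-- The information contained in the first `l` event times. -/
abbrev pastSigma {Ω : Type u} (t : ℕ → Ω → ℝ) (l : ℕ) : MeasurableSpace Ω :=
  ⨆ j : Fin l, MeasurableSpace.comap (t j) inferInstance

/-- `t 0 < t 1 < …` are the event times of a Hawkes process on `(0, ∞)` with empty history at time
`0`, baseline rate `μ` and kernel `α exp (-β ·)`: given the first `l` event times, the waiting time
for the next event has hazard rate equal to the conditional intensity, i.e.
`P (t l > s | t 0, …, t (l - 1)) = exp (- ∫_{t (l - 1)}^s λ)` for `s ≥ t (l - 1)`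
(and `1` for `s < t (l - 1)`). -/
structure IsHawkes {Ω : Type u} [MeasurableSpace Ω] (P : Measure Ω) (μ α β : ℝ)
    (t : ℕ → Ω → ℝ) : Prop where
  measurable : ∀ l, Measurable (t l)
  increasing : ∀ᵐ ω ∂P, ∀ l, prevTime (fun j => t j ω) l < t l ω
  survival : ∀ (l : ℕ) (s : ℝ),
    P[Set.indicator {ω | s < t l ω} (fun _ => (1 : ℝ)) | pastSigma t l] =ᵐ[P]
      fun ω => Real.exp (-(∫ x in (prevTime (fun j => t j ω) l)..
        (max s (prevTime (fun j => t j ω) l)), hawkesIntensity μ α β (fun j => t j ω) l x))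

/-! ### The (undirected) CHIP model -/

/-- `t i j`, for `i < j`, are the sequences of event times between the nodes `i` and `j` in the
CHIP model with community assignment `c` and parameter matrices `μ, α, β`: independent Hawkes
processes, one for each pair of nodes, with parameters depending on the communities of the
two nodes. -/
structure IsCHIP {Ω : Type u} [MeasurableSpace Ω] (P : Measure Ω) {n k : ℕ} (c : Fin n → Fin k)
    (μ α β : Fin k → Fin k → ℝ) (t : Fin n → Fin n → ℕ → Ω → ℝ) : Prop where
  hawkes : ∀ i j, i < j → IsHawkes P (μ (c i) (c j)) (α (c i) (c j)) (β (c i) (c j)) (t i j)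
  indep : iIndepFun
    (fun (p : {p : Fin n × Fin n // p.1 < p.2}) (ω : Ω) (l : ℕ) => t p.1.1 p.1.2 l ω) P

/-- Parameter matrix with value `x₁` within communities and `x₂` between communities. -/
def twoValued {k : ℕ} (x₁ x₂ : ℝ) (a b : Fin k) : ℝ := if a = b then x₁ else x₂

/-- Size of the community `a`. -/
def communitySize {n k : ℕ} (c : Fin n → Fin k) (a : Fin k) : ℕ :=
  (Finset.univ.filter (fun i => c i = a)).card

/-- All `k` communities have `n / k` elements. -/
def Balanced {n k : ℕ} (c : Fin n → Fin k) : Prop := ∀ a, k * communitySize c a = n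

/-- The simplified model: equal communities, one parameter set `(μ₁, α₁, β₁)` within communities
and one parameter set `(μ₂, α₂, β₂)` between communities. -/
def IsSimplifiedCHIP {Ω : Type u} [MeasurableSpace Ω] (P : Measure Ω) {n k : ℕ}
    (c : Fin n → Fin k) (μ₁ α₁ β₁ μ₂ α₂ β₂ : ℝ) (t : Fin n → Fin n → ℕ → Ω → ℝ) : Prop :=
  Balanced c ∧ IsCHIP P c (twoValued μ₁ μ₂) (twoValued α₁ α₂) (twoValued β₁ β₂) t

/-- `ν = μ / (1 - m)` with `m = α / β`. -/
def nu (μ α β : ℝ) : ℝ := μ / (1 - α / β)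

/-- `σ = √(μ / (1 - m) ^ 3)` with `m = α / β`. -/
def sigma (μ α β : ℝ) : ℝ := Real.sqrt (μ / (1 - α / β) ^ 3)

/-- Assumptions on the two parameter sets: positive parameters of stationary Hawkes processes,
`ν₁ > ν₂`, and `ν₁ ≍ ν₂`, `σ₁ ≍ σ₂` with constant `K`. -/
structure ParamsOK (K μ₁ α₁ β₁ μ₂ α₂ β₂ : ℝ) : Prop where
  mu₁_pos : 0 < μ₁
  mu₂_pos : 0 < μ₂
  alpha₁_pos : 0 < α₁
  alpha₂_pos : 0 < α₂
  alpha₁_lt : α₁ < β₁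
  alpha₂_lt : α₂ < β₂
  nu_lt : nu μ₂ α₂ β₂ < nu μ₁ α₁ β₁
  nu_le : nu μ₁ α₁ β₁ ≤ K * nu μ₂ α₂ β₂
  sigma_le : sigma μ₁ α₁ β₁ ≤ K * sigma μ₂ α₂ β₂
  sigma_ge : sigma μ₂ α₂ β₂ ≤ K * sigma μ₁ α₁ β₁

/-- `N i j`: the number of events between the nodes `i ≠ j` up to time `T`. -/
def eventCount {Ω : Type u} {n : ℕ} (t : Fin n → Fin n → ℕ → Ω → ℝ) (T : ℝ) (ω : Ω)
    (i j : Fin n) : ℕ∞ :=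
  {l : ℕ | t (min i j) (max i j) l ω ≤ T}.encard

open Classical in
/-- The binary symmetric adjacency matrix at time `T`, without self-edges. -/
def adjacency {Ω : Type u} {n : ℕ} (t : Fin n → Fin n → ℕ → Ω → ℝ) (T : ℝ) (ω : Ω) :
    Matrix (Fin n) (Fin n) ℝ :=
  Matrix.of fun i j => if i ≠ j ∧ 0 < eventCount t T ω i j then 1 else 0

/-! ### Spectral clustering -/

/-- `U 0, …, U (k - 1)` are orthonormal eigenvectors of `A` for its `k` eigenvalues of largest
absolute value (with multiplicity): no eigenvector orthogonal to all of them has an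
eigenvalue of larger absolute value. -/
def IsLeadingEigenvectors {n k : ℕ} (A : Matrix (Fin n) (Fin n) ℝ)
    (U : Fin k → EuclideanSpace ℝ (Fin n)) : Prop :=
  Orthonormal ℝ U ∧ ∃ lam : Fin k → ℝ,
    (∀ j, Matrix.toEuclideanLin A (U j) = lam j • U j) ∧
    ∀ (v : EuclideanSpace ℝ (Fin n)) (x : ℝ), v ≠ 0 → Matrix.toEuclideanLin A v = x • v →
      (∀ j, inner ℝ (U j) v = 0) → ∀ j, |x| ≤ |lam j|

/-- The row of the node `i` in the `n × k` matrix with columns `U 0, …, U (k - 1)`. -/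
def spectralRow {n k : ℕ} (U : Fin k → EuclideanSpace ℝ (Fin n)) (i : Fin n) :
    EuclideanSpace ℝ (Fin k) :=
  WithLp.toLp 2 (fun j => U j i)

/-- The `k`-means objective for points `x i`, labels `z i` and centers `M a`. -/
def kmeansCost {n k : ℕ} (x : Fin n → EuclideanSpace ℝ (Fin k)) (z : Fin n → Fin k)
    (M : Fin k → EuclideanSpace ℝ (Fin k)) : ℝ :=
  ∑ i, ‖x i - M (z i)‖ ^ 2

/-- `z` is a possible output of spectral clustering of `A` into `k` clusters: the labels of a
`(1 + ε)`-approximate solution of the `k`-means problem for the rows of the matrix of the `k`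
leading eigenvectors of `A`. -/
def IsSpectralClustering {n k : ℕ} (ε : ℝ) (A : Matrix (Fin n) (Fin n) ℝ) (z : Fin n → Fin k) :
    Prop :=
  ∃ U : Fin k → EuclideanSpace ℝ (Fin n), IsLeadingEigenvectors A U ∧
    ∃ M, ∀ z' M', kmeansCost (spectralRow U) z M ≤ (1 + ε) * kmeansCost (spectralRow U) z' M'

/-- Fraction of misclustered nodes, up to a permutation of the community labels. -/
def misclusteringError {n k : ℕ} (c z : Fin n → Fin k) : ℝ :=
  ⨅ π : Equiv.Perm (Fin k), (1 / (n : ℝ)) * ∑ i, if c i ≠ π (z i) then (1 : ℝ) else 0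

/-! ### The general upper bound for the error of spectral clustering on the adjacency matrix -/

/-- The block matrix `E[A]` of edge probabilities, `1 - exp (-μ_{ab} T)` for nodes in the
communities `a` and `b`; as usual for block models, the formula is also used on the diagonal. -/
def edgeProb {n k : ℕ} (c : Fin n → Fin k) (μ : Fin k → Fin k → ℝ) (T : ℝ) :
    Matrix (Fin n) (Fin n) ℝ :=
  Matrix.of fun i j => 1 - Real.exp (-(μ (c i) (c j) * T))

/-- The minimum in absolute value of the non-zero eigenvalues. -/
def lambdaMin {n : ℕ} (B : Matrix (Fin n) (Fin n) ℝ) : ℝ :=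
  sInf {y | ∃ x : ℝ, Module.End.HasEigenvalue (Matrix.toLin' B) x ∧ x ≠ 0 ∧ y = |x|}

/-- `Δ = max {n max_{i,j} E[A_{ij}], c₀ log n}`. -/
def Delta {n k : ℕ} (c₀ : ℝ) (c : Fin n → Fin k) (μ : Fin k → Fin k → ℝ) (T : ℝ) : ℝ :=
  max ((n : ℝ) * ⨆ p : Fin n × Fin n, edgeProb c μ T p.1 p.2) (c₀ * Real.log n)

/-- The size of the largest community. -/
def maxCommunity {n k : ℕ} (c : Fin n → Fin k) : ℕ := Finset.univ.sup (communitySize c)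

/-- The bound `64 (2 + ε) |a|_max k C Δ / (n λ_min(E[A])²)` for the misclustering error, with
constants `ε`, `C`, `c₀`. -/
def generalBound {n k : ℕ} (ε C c₀ : ℝ) (c : Fin n → Fin k) (μ : Fin k → Fin k → ℝ) (T : ℝ) : ℝ :=
  64 * (2 + ε) * ((maxCommunity c : ℝ) * k * C * Delta c₀ c μ T /
    (n * lambdaMin (edgeProb c μ T) ^ 2))

end CHIP

end

noncomputable section

namespace CHIP


/-! ### Misclustering error of a labelling that separates all but a few nodes -/

/-! The adjacency matrix sees a pair of nodes only through its first event. Before that event the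
intensity is the baseline rate, so the entries above the diagonal are independent Bernoulli
variables with the means of a block matrix, whatever the excitation kernel. Hence the first claim is
about spectral clustering of a stochastic block model, and two bounds carry it.

Deterministic part (`misclusteringError_le_of_close`): let the adjacency matrix be within `δ` of the
block matrix in operator norm. The block matrix has rank at most `k` and on the span of the
community vectors an inverse of norm at most `(n / k |p - q|)⁻¹`. By a Weyl and Davis-Kahan type
argument the community vectors are then within `2 δ / (n / k |p - q|)` of the span of the leading
eigenvectors. So the spectral rows cluster around separated centers, and an approximate `k`-means
solution misplaces a fraction of order `(δ / (n / k |p - q|)) ^ 2` of the nodes.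

Random part (`measureReal_norm_symMatrix_le`): the noise has norm `O (√p)` up to probability `n exp
(-p)` once `n q ≤ p`, where `q` is the largest edge probability. This is the trace method without
walk counting. In the expected trace of the power `2 p` only closed walks without simply used edges
survive. Sorted by their pattern of coincidences they are compared with such walks on `2 p + 1`
vertices, whose number is at most the expected trace for a matrix with a skewed two-point law. That
matrix is subgaussian of size `2 p + 1`, so a net bounds its trace.

Taking `p` of order `n q`, which dominates `log n`, gives `δ ^ 2` of order `n q`. The assumptions on
`ν` and `σ` bound `q` by `K` times the probability within communities (`ParamsOK.mu₂_le`), which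
yields the first claim. The sparse form follows from `1 - exp (-x) ≍ x` near `0`. In the dense
regime both probabilities tend to `1`, so the eigenvalue `n / k (p - q)` vanishes while `Δ` stays at
least `n / 2`. -/

lemma misclusteringError_le_of_perm {n k : ℕ} (c z : Fin n → Fin k) (π : Equiv.Perm (Fin k)) :
    misclusteringError c z ≤ (1 / (n : ℝ)) * ∑ i, if c i ≠ π (z i) then (1 : ℝ) else 0 :=
  ciInf_le (Set.Finite.bddBelow (Set.finite_range _)) π

lemma misclusteringError_le_one {n k : ℕ} (c z : Fin n → Fin k) :
    misclusteringError c z ≤ 1 := by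
  refine (misclusteringError_le_of_perm c z 1).trans ?_
  have h : (∑ i, if c i ≠ (1 : Equiv.Perm (Fin k)) (z i) then (1 : ℝ) else 0) ≤ ∑ _i : Fin n, 1 :=
    Finset.sum_le_sum fun i _ => by split_ifs <;> norm_num
  rcases Nat.eq_zero_or_pos n with rfl | hn
  · simp
  · have hn' : (0 : ℝ) < n := by exact_mod_cast hn
    rw [one_div, inv_mul_le_iff₀ hn']
    simpa using h

/-- If outside `S` equal labels imply equal communities, at most `2 |S|` nodes are misclustered,
even if `S` contains whole communities. -/
lemma misclusteringError_le_of_separated {n k : ℕ} {c z : Fin n → Fin k} (hc : Balanced c)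
    (S : Finset (Fin n)) (h : ∀ i ∉ S, ∀ j ∉ S, z i = z j → c i = c j) :
    misclusteringError c z ≤ 2 * S.card / n := by
  classical
  let G : Finset (Fin k) := Finset.univ.filter fun a => ∃ i, i ∉ S ∧ c i = a
  have hrep : ∀ a : G, ∃ i, i ∉ S ∧ c i = a := fun a => by
    have := a.2
    simp only [G, Finset.mem_filter, Finset.mem_univ, true_and] at this
    exact this
  choose rep hrepS hrepc using hrep
  let f : G → Fin k := fun a => z (rep a)
  have hf : Function.Injective f := fun a b hab => by
    have := h _ (hrepS a) _ (hrepS b) hab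
    rw [hrepc, hrepc] at this
    exact Subtype.ext this
  obtain ⟨e, he⟩ : ∃ e : Equiv.Perm (Fin k), ∀ a : G, e a = f a := by
    let e₀ : {x // x ∈ G} ≃ {x // x ∈ Set.range f} := Equiv.ofInjective f hf
    exact ⟨e₀.extendSubtype, fun a => by rw [Equiv.extendSubtype_apply_of_mem _ _ a.2]; rfl⟩
  -- `G` holds the communities not swallowed by `S`; representatives give them distinct labels, and
  -- `e` extends this to a permutation. A node of `R` must carry the label `e b` of some `b ∉ G`,
  -- and each such label is used in `R` by at most one community. By equal sizes, `R` is no larger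
  -- than the union of the communities outside `G`, which lies in `S`.
  let R : Finset (Fin n) := (Finset.univ \ S).filter fun i => z i ≠ e (c i)
  let comm : Fin k → Finset (Fin n) := fun a => Finset.univ.filter fun i => c i = a
  have hsize : ∀ a b, (comm a).card = (comm b).card := fun a b => by
    have ha := hc a
    have hb := hc b
    have hk : 0 < k := a.pos
    exact Nat.eq_of_mul_eq_mul_left hk (ha.trans hb.symm)
  have hRmaps : ∀ i ∈ R, z i ∈ (Finset.univ \ G).image e := by
    intro i hi
    simp only [R, Finset.mem_filter, Finset.mem_sdiff, Finset.mem_univ, true_and] at hi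
    obtain ⟨b, hb⟩ := e.surjective (z i)
    refine Finset.mem_image.2 ⟨b, ?_, hb⟩
    simp only [Finset.mem_sdiff, Finset.mem_univ, true_and]
    intro hbG
    have h1 : z (rep ⟨b, hbG⟩) = z i := by
      rw [← hb]; exact (he ⟨b, hbG⟩).symm
    have h2 := h _ (hrepS ⟨b, hbG⟩) _ hi.1 h1
    rw [hrepc] at h2
    exact hi.2 (by rw [← h2, hb])
  have hRfib : ∀ a, (R.filter fun i => z i = e a).card ≤ (comm a).card := by
    intro a
    rcases Finset.eq_empty_or_nonempty (R.filter fun i => z i = e a) with h0 | ⟨j, hj⟩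
    · simp [h0]
    · rw [hsize a (c j)]
      refine Finset.card_le_card fun i hi => ?_
      simp only [R, comm, Finset.mem_filter, Finset.mem_sdiff, Finset.mem_univ, true_and] at hi hj ⊢
      exact h _ hi.1.1 _ hj.1.1 (hi.2.trans hj.2.symm)
  have hRcard : R.card ≤ S.card := by
    calc R.card = ∑ l ∈ (Finset.univ \ G).image e, (R.filter fun i => z i = l).card :=
          Finset.card_eq_sum_card_fiberwise hRmaps
      _ = ∑ a ∈ Finset.univ \ G, (R.filter fun i => z i = e a).card :=
          Finset.sum_image fun a _ b _ hab => e.injective hab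
      _ ≤ ∑ a ∈ Finset.univ \ G, (comm a).card := Finset.sum_le_sum fun a _ => hRfib a
      _ = ((Finset.univ \ G).biUnion comm).card := by
          refine (Finset.card_biUnion fun a _ b _ hab => ?_).symm
          refine Finset.disjoint_left.2 fun i hi hj => hab ?_
          simp only [comm, Finset.mem_filter, Finset.mem_univ, true_and] at hi hj
          exact hi.symm.trans hj
      _ ≤ S.card := by
          refine Finset.card_le_card fun i hi => ?_
          simp only [comm, G, Finset.mem_biUnion, Finset.mem_sdiff, Finset.mem_filter,
            Finset.mem_univ, true_and] at hi
          obtain ⟨a, ha, rfl⟩ := hi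
          by_contra hiS
          exact ha ⟨i, hiS, rfl⟩
  refine (misclusteringError_le_of_perm c z e.symm).trans ?_
  have hcount : (∑ i, if c i ≠ e.symm (z i) then (1 : ℝ) else 0) ≤ 2 * S.card := by
    rw [Finset.sum_boole]
    have hsub : (Finset.univ.filter fun i => c i ≠ e.symm (z i)) ⊆ S ∪ R := by
      intro i hi
      simp only [Finset.mem_filter, Finset.mem_univ, true_and] at hi
      by_cases hiS : i ∈ S
      · exact Finset.mem_union_left _ hiS
      · refine Finset.mem_union_right _ ?_
        simp only [R, Finset.mem_filter, Finset.mem_sdiff, Finset.mem_univ, true_and]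
        exact ⟨hiS, fun hz => hi (by rw [hz, Equiv.symm_apply_apply])⟩
    have h1 := (Finset.card_le_card hsub).trans (Finset.card_union_le S R)
    have h2 : (Finset.univ.filter fun i => c i ≠ e.symm (z i)).card ≤ 2 * S.card := by omega
    exact_mod_cast h2
  rw [one_div, div_eq_inv_mul]
  gcongr

/-! ### Approximate `k`-means -/

/-- A near-optimal `k`-means solution, for points that are close to well separated centers. -/
lemma misclusteringError_le_of_kmeans {n k : ℕ} {c z : Fin n → Fin k} (hc : Balanced c)
    {x : Fin n → EuclideanSpace ℝ (Fin k)} {M m : Fin k → EuclideanSpace ℝ (Fin k)}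
    {ε η s : ℝ} (hε : 0 < ε) (hs : 0 < s)
    (hsep : ∀ a b, a ≠ b → s ≤ ‖m a - m b‖ ^ 2)
    (hη : kmeansCost x c m ≤ η)
    (hM : kmeansCost x z M ≤ (1 + ε) * kmeansCost x c m) :
    misclusteringError c z ≤ 2 * (4 / s * ((4 + 2 * ε) * η)) / n := by
  classical
  -- Nodes whose fitted center is at least half the separation away from the true one. Two nodes
  -- outside `S` with a common fitted center have true centers closer than the separation.
  let S : Finset (Fin n) := Finset.univ.filter fun i => s / 4 ≤ ‖M (z i) - m (c i)‖ ^ 2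
  have hsum : ∑ i, ‖M (z i) - m (c i)‖ ^ 2 ≤ (4 + 2 * ε) * η := by
    have h1 : ∀ i, ‖M (z i) - m (c i)‖ ^ 2 ≤
        2 * ‖x i - M (z i)‖ ^ 2 + 2 * ‖x i - m (c i)‖ ^ 2 := fun i => by
      have h := norm_sub_le (x i - m (c i)) (x i - M (z i))
      rw [sub_sub_sub_cancel_left] at h
      nlinarith [norm_nonneg (M (z i) - m (c i)), sq_nonneg (‖x i - m (c i)‖ - ‖x i - M (z i)‖)]
    calc ∑ i, ‖M (z i) - m (c i)‖ ^ 2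
        ≤ ∑ i, (2 * ‖x i - M (z i)‖ ^ 2 + 2 * ‖x i - m (c i)‖ ^ 2) :=
          Finset.sum_le_sum fun i _ => h1 i
      _ = 2 * kmeansCost x z M + 2 * kmeansCost x c m := by
          rw [Finset.sum_add_distrib, ← Finset.mul_sum, ← Finset.mul_sum]; rfl
      _ ≤ 2 * ((1 + ε) * kmeansCost x c m) + 2 * kmeansCost x c m := by gcongr
      _ = (4 + 2 * ε) * kmeansCost x c m := by ring
      _ ≤ _ := by gcongr
  have hcard : (S.card : ℝ) ≤ 4 / s * ((4 + 2 * ε) * η) := by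
    have h2 : S.card • (s / 4) ≤ ∑ i ∈ S, ‖M (z i) - m (c i)‖ ^ 2 :=
      Finset.card_nsmul_le_sum _ _ _ fun i hi => (Finset.mem_filter.1 hi).2
    have h3 : ∑ i ∈ S, ‖M (z i) - m (c i)‖ ^ 2 ≤ ∑ i, ‖M (z i) - m (c i)‖ ^ 2 :=
      Finset.sum_le_sum_of_subset_of_nonneg (Finset.subset_univ _) fun _ _ _ => sq_nonneg _
    have h4 := h2.trans (h3.trans hsum)
    rw [nsmul_eq_mul] at h4
    rw [div_mul_eq_mul_div, le_div_iff₀ hs]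
    linarith
  have hsepS : ∀ i ∉ S, ∀ j ∉ S, z i = z j → c i = c j := by
    intro i hi j hj hz
    by_contra hne
    simp only [S, Finset.mem_filter, Finset.mem_univ, true_and, not_le] at hi hj
    rw [hz] at hi
    have h5 := hsep _ _ hne
    have h6 := norm_sub_le (M (z j) - m (c j)) (M (z j) - m (c i))
    rw [sub_sub_sub_cancel_left] at h6
    nlinarith [norm_nonneg (m (c i) - m (c j)),
      sq_nonneg (‖M (z j) - m (c j)‖ - ‖M (z j) - m (c i)‖)]
  refine (misclusteringError_le_of_separated hc S hsepS).trans ?_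
  gcongr


/-! ### Subspace perturbation: leading eigenvectors of an operator close to one of low rank. -/

section Residual

variable {E : Type*} [NormedAddCommGroup E] [InnerProductSpace ℝ E]

/-- The component of `x` orthogonal to the orthonormal family `U`. -/
def residual {k : ℕ} (U : Fin k → E) (x : E) : E := x - ∑ j, inner ℝ (U j) x • U j

lemma residual_sub {k : ℕ} (U : Fin k → E) (x y : E) :
    residual U (x - y) = residual U x - residual U y := by
  simp only [residual, inner_sub_right, sub_smul, Finset.sum_sub_distrib]
  abel

lemma inner_residual {k : ℕ} {U : Fin k → E} (hU : Orthonormal ℝ U) (x : E) (j : Fin k) :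
    inner ℝ (U j) (residual U x) = 0 := by
  rw [residual, inner_sub_right, hU.inner_right_fintype, sub_self]

lemma norm_sq_residual {k : ℕ} {U : Fin k → E} (hU : Orthonormal ℝ U) (x : E) :
    ‖residual U x‖ ^ 2 = ‖x‖ ^ 2 - ∑ j, inner ℝ (U j) x ^ 2 := by
  have h1 : inner ℝ (∑ j, inner ℝ (U j) x • U j) (residual U x) = 0 := by
    rw [sum_inner]
    exact Finset.sum_eq_zero fun j _ => by rw [inner_smul_left, inner_residual hU, mul_zero]
  have h2 : ‖∑ j, inner ℝ (U j) x • U j‖ ^ 2 = ∑ j, inner ℝ (U j) x ^ 2 := by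
    rw [← real_inner_self_eq_norm_sq, hU.inner_sum]
    exact Finset.sum_congr rfl fun j _ => by simp [sq]
  have h3 : x = (∑ j, inner ℝ (U j) x • U j) + residual U x := by rw [residual]; abel
  have h4 : ‖x‖ ^ 2 = ‖∑ j, inner ℝ (U j) x • U j‖ ^ 2 + ‖residual U x‖ ^ 2 := by
    conv_lhs => rw [h3]
    rw [norm_add_sq_real, h1]; ring
  linarith

lemma norm_residual_le {k : ℕ} {U : Fin k → E} (hU : Orthonormal ℝ U) (x : E) :
    ‖residual U x‖ ≤ ‖x‖ := by
  have h := norm_sq_residual hU x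
  have h' : 0 ≤ ∑ j, inner ℝ (U j) x ^ 2 := Finset.sum_nonneg fun _ _ => sq_nonneg _
  exact le_of_sq_le_sq (by linarith) (norm_nonneg _)

/-- A symmetric operator preserves the span of its eigenvectors and the orthogonal complement, so it
commutes with the projections. -/
lemma residual_map {k : ℕ} {U : Fin k → E} {A : E →ₗ[ℝ] E} (hA : A.IsSymmetric) {lam : Fin k → ℝ}
    (hlam : ∀ j, A (U j) = lam j • U j) (x : E) :
    residual U (A x) = A (residual U x) := by
  simp only [residual, map_sub, map_sum, map_smul, hlam]
  congr 1
  refine Finset.sum_congr rfl fun j _ => ?_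
  rw [← hA, hlam, inner_smul_left, smul_smul, mul_comm]
  rfl

variable [FiniteDimensional ℝ E]

/-- Weyl's inequality for the eigenvalues beyond the `k` leading ones, if `A` is `δ`-close to an
operator of rank at most `k`. -/
lemma abs_eigenvalue_le_of_rank_le {k : ℕ} {U : Fin k → E} (hU : Orthonormal ℝ U)
    {A R : E →ₗ[ℝ] E} {lam : Fin k → ℝ}
    (hlam : ∀ j, A (U j) = lam j • U j) (hR : Module.finrank ℝ (LinearMap.range R) ≤ k)
    {δ : ℝ} (hδ : ∀ w, ‖A w - R w‖ ≤ δ * ‖w‖) {v : E} {x : ℝ} (hv : ‖v‖ = 1)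
    (hAv : A v = x • v) (hvU : ∀ j, inner ℝ (U j) v = 0) (hx : ∀ j, |x| ≤ |lam j|) :
    |x| ≤ δ := by
  -- With `v` added there are `k + 1` orthonormal eigenvectors, all with eigenvalues at least `|x|`
  -- in absolute value, so `A` expands their span by at least `|x|`.
  let b : Fin (k + 1) → E := Fin.cons v U
  let μ : Fin (k + 1) → ℝ := Fin.cons x lam
  have hb : Orthonormal ℝ b := by
    rw [orthonormal_iff_ite] at hU ⊢
    intro i j
    refine Fin.cases ?_ (fun i => ?_) i <;> refine Fin.cases ?_ (fun j => ?_) j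
    · simp [b, hv]
    · simp [b, real_inner_comm _ v, hvU, (Fin.succ_ne_zero j).symm]
    · simp [b, hvU, Fin.succ_ne_zero]
    · simp [b, hU]
  have hAb : ∀ i, A (b i) = μ i • b i := by
    intro i
    refine Fin.cases ?_ (fun i => ?_) i
    · simpa [b, μ] using hAv
    · simpa [b, μ] using hlam i
  have hμ : ∀ i, x ^ 2 ≤ μ i ^ 2 := by
    intro i
    refine Fin.cases ?_ (fun i => ?_) i
    · simp [μ]
    · simpa [μ] using sq_le_sq.2 (hx i)
  -- The rank of `R` is too small for injectivity on this span; on a vector `w` of its kernel, `A w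
  -- = A w - R w` has norm at most `δ ‖w‖`.
  let f : (Fin (k + 1) → ℝ) →ₗ[ℝ] LinearMap.range R :=
    R.rangeRestrict ∘ₗ Fintype.linearCombination ℝ b
  have hker : LinearMap.ker f ≠ ⊥ := LinearMap.ker_ne_bot_of_finrank_lt (by
    rw [Module.finrank_fin_fun]; omega)
  obtain ⟨a, ha, ha0⟩ := (Submodule.ne_bot_iff _).1 hker
  let w := ∑ i, a i • b i
  have hRw : R w = 0 := by
    have h := congrArg Subtype.val (LinearMap.mem_ker.1 ha)
    simpa [f, w, Fintype.linearCombination_apply] using h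
  have hw : ‖w‖ ^ 2 = ∑ i, a i ^ 2 := by
    rw [← real_inner_self_eq_norm_sq, hb.inner_sum]
    exact Finset.sum_congr rfl fun j _ => by simp [sq]
  have hAw : ‖A w‖ ^ 2 = ∑ i, (a i * μ i) ^ 2 := by
    have h1 : A w = ∑ i, (a i * μ i) • b i := by
      simp only [w, map_sum, map_smul, hAb, smul_smul]
    rw [h1, ← real_inner_self_eq_norm_sq, hb.inner_sum]
    exact Finset.sum_congr rfl fun j _ => by simp [sq]
  have hwpos : 0 < ‖w‖ := by
    have h : 0 < ‖w‖ ^ 2 := by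
      rw [hw]
      obtain ⟨i, hi⟩ := Function.ne_iff.1 ha0
      exact Finset.sum_pos' (fun _ _ => sq_nonneg _) ⟨i, Finset.mem_univ _, by
        have : a i ≠ 0 := hi
        positivity⟩
    exact lt_of_le_of_ne (norm_nonneg _) fun h0 => by simp [← h0] at h
  have h2 : (|x| * ‖w‖) ^ 2 ≤ ‖A w‖ ^ 2 := by
    rw [mul_pow, sq_abs, hw, hAw, Finset.mul_sum]
    exact Finset.sum_le_sum fun i _ => by
      rw [mul_pow, mul_comm]; exact mul_le_mul_of_nonneg_left (hμ i) (sq_nonneg _)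
  have h3 : |x| * ‖w‖ ≤ ‖A w‖ := le_of_sq_le_sq h2 (norm_nonneg _)
  have h4 := hδ w
  rw [hRw, sub_zero] at h4
  exact le_of_mul_le_mul_right (h3.trans h4) hwpos

lemma norm_map_le_of_eigenvalues {m : ℕ} {A : E →ₗ[ℝ] E}
    (hA : A.IsSymmetric) (hm : Module.finrank ℝ E = m) {δ : ℝ}
    (h : ∀ i, |hA.eigenvalues hm i| ≤ δ) (w : E) : ‖A w‖ ≤ δ * ‖w‖ := by
  rcases Nat.eq_zero_or_pos m with h0 | h0
  · have : Subsingleton E := Module.finrank_zero_iff.1 (hm.trans h0)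
    simp [Subsingleton.elim w 0]
  have hδ : 0 ≤ δ := (abs_nonneg _).trans (h ⟨0, h0⟩)
  refine le_of_sq_le_sq ?_ (by positivity)
  rw [mul_pow, ← LinearIsometryEquiv.norm_map (hA.eigenvectorBasis hm).repr (A w),
    ← LinearIsometryEquiv.norm_map (hA.eigenvectorBasis hm).repr w,
    EuclideanSpace.norm_sq_eq, EuclideanSpace.norm_sq_eq, Finset.mul_sum]
  refine Finset.sum_le_sum fun i _ => ?_
  rw [hA.eigenvectorBasis_apply_self_apply]
  simp only [RCLike.ofReal_real_eq_id, id_eq, norm_mul, mul_pow, Real.norm_eq_abs, sq_abs]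
  refine mul_le_mul_of_nonneg_right ?_ (sq_nonneg _)
  rw [← sq_abs]
  exact pow_le_pow_left₀ (abs_nonneg _) (h i) 2

/-- Orthogonally to the `k` leading eigenvectors, a symmetric operator that is `δ`-close to an
operator of rank at most `k` has norm at most `δ`. -/
lemma norm_map_residual_le {k : ℕ} {U : Fin k → E} (hU : Orthonormal ℝ U)
    {A R : E →ₗ[ℝ] E} (hA : A.IsSymmetric) {lam : Fin k → ℝ}
    (hlam : ∀ j, A (U j) = lam j • U j)
    (hlead : ∀ (v : E) (x : ℝ), v ≠ 0 → A v = x • v → (∀ j, inner ℝ (U j) v = 0) →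
      ∀ j, |x| ≤ |lam j|)
    (hR : Module.finrank ℝ (LinearMap.range R) ≤ k)
    {δ : ℝ} (hδ : ∀ w, ‖A w - R w‖ ≤ δ * ‖w‖) (x : E) :
    ‖A (residual U x)‖ ≤ δ * ‖residual U x‖ := by
  let S : Submodule ℝ E := (Submodule.span ℝ (Set.range U))ᗮ
  have hmem : ∀ w, w ∈ S ↔ ∀ j, inner ℝ (U j) w = 0 := fun w => by
    rw [Submodule.mem_orthogonal]
    refine ⟨fun h j => h _ (Submodule.subset_span ⟨j, rfl⟩), fun h u hu => ?_⟩
    induction hu using Submodule.span_induction with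
    | mem y hy => obtain ⟨j, rfl⟩ := hy; exact h j
    | zero => exact inner_zero_left _
    | add y z _ _ hy hz => rw [inner_add_left, hy, hz, add_zero]
    | smul r y _ hy => rw [inner_smul_left, hy, mul_zero]
  have hinv : ∀ w ∈ S, A w ∈ S := fun w hw => by
    rw [hmem] at hw ⊢
    intro j
    rw [← hA, hlam, inner_smul_left, hw, mul_zero]
  have hS := hA.restrict_invariant hinv
  -- An eigenvector of the restriction is an eigenvector of `A` orthogonal to `U`; maximality of `U`
  -- puts its eigenvalue after the leading ones, where Weyl's inequality applies.
  have hev : ∀ i, |hS.eigenvalues rfl i| ≤ δ := fun i => by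
    have h1 := hS.apply_eigenvectorBasis rfl i
    have h2 := (hS.eigenvectorBasis rfl).norm_eq_one i
    generalize hS.eigenvectorBasis rfl i = v at h1 h2
    have h1' : A v = hS.eigenvalues rfl i • (v : E) := by
      simpa using congrArg Subtype.val h1
    have hv0 : (v : E) ≠ 0 := fun h => by
      rw [Submodule.coe_norm, h, norm_zero] at h2; exact zero_ne_one h2
    exact abs_eigenvalue_le_of_rank_le hU hlam hR hδ (by simpa using h2) h1'
      ((hmem _).1 v.2) (hlead _ _ hv0 h1' ((hmem _).1 v.2))
  have h3 := norm_map_le_of_eigenvalues hS rfl hev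
    ⟨residual U x, (hmem _).2 (inner_residual hU x)⟩
  simpa using h3

/-- A vector in the range of the rank `k` operator is almost a combination of the leading
eigenvectors. -/
lemma norm_residual_le_of_leading {k : ℕ} {U : Fin k → E} (hU : Orthonormal ℝ U)
    {A R : E →ₗ[ℝ] E} (hA : A.IsSymmetric) {lam : Fin k → ℝ}
    (hlam : ∀ j, A (U j) = lam j • U j)
    (hlead : ∀ (v : E) (x : ℝ), v ≠ 0 → A v = x • v → (∀ j, inner ℝ (U j) v = 0) →
      ∀ j, |x| ≤ |lam j|)
    (hR : Module.finrank ℝ (LinearMap.range R) ≤ k)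
    {δ : ℝ} (hδ0 : 0 ≤ δ) (hδ : ∀ w, ‖A w - R w‖ ≤ δ * ‖w‖) (z : E) :
    ‖residual U (R z)‖ ≤ 2 * δ * ‖z‖ := by
  -- Each term costs one `δ`: the first because `A` is small on residuals, the second because
  -- projecting does not increase the norm.
  have h1 : R z = A z - (A z - R z) := by abel
  rw [h1, residual_sub, residual_map hA hlam]
  have h2 := norm_map_residual_le hU hA hlam hlead hR hδ z
  have h3 := (norm_residual_le hU (A z - R z)).trans (hδ z)
  have h4 : δ * ‖residual U z‖ ≤ δ * ‖z‖ := by gcongr; exact norm_residual_le hU z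
  linarith [norm_sub_le (A (residual U z)) (residual U (A z - R z))]

end Residual


section Model


/-! ### The block matrix of edge probabilities -/

/-- The block matrix with entry `p` within and `q` between communities. -/
def blockMatrix {n k : ℕ} (c : Fin n → Fin k) (p q : ℝ) : Matrix (Fin n) (Fin n) ℝ :=
  Matrix.of fun i j => if c i = c j then p else q

lemma edgeProb_twoValued {n k : ℕ} (c : Fin n → Fin k) (μ₁ μ₂ T : ℝ) :
    edgeProb c (twoValued μ₁ μ₂) T =
      blockMatrix c (1 - Real.exp (-(μ₁ * T))) (1 - Real.exp (-(μ₂ * T))) := by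
  ext i j
  simp only [edgeProb, twoValued, blockMatrix, Matrix.of_apply]
  split_ifs <;> rfl

/-- The normalized indicator vector of a community. -/
def communityVec {n k : ℕ} (c : Fin n → Fin k) (a : Fin k) : EuclideanSpace ℝ (Fin n) :=
  WithLp.toLp 2 fun i => if c i = a then √((k : ℝ) / n) else 0

lemma communityVec_apply {n k : ℕ} (c : Fin n → Fin k) (a : Fin k) (i : Fin n) :
    communityVec c a i = if c i = a then √((k : ℝ) / n) else 0 := rfl

lemma inner_communityVec {n k : ℕ} (c : Fin n → Fin k) (a : Fin k)
    (w : EuclideanSpace ℝ (Fin n)) :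
    inner ℝ (communityVec c a) w =
      √((k : ℝ) / n) * ∑ j ∈ Finset.univ.filter (fun j => c j = a), w j := by
  simp only [PiLp.inner_apply, communityVec_apply, Finset.mul_sum, Finset.sum_filter]
  refine Finset.sum_congr rfl fun j _ => ?_
  split_ifs <;> simp [mul_comm]

lemma sum_smul_communityVec_apply {n k : ℕ} (c : Fin n → Fin k) (x : Fin k → ℝ) (i : Fin n) :
    (∑ a, x a • communityVec c a) i = √((k : ℝ) / n) * x (c i) := by
  simp [communityVec_apply, mul_comm]

variable {n k : ℕ} {c : Fin n → Fin k}

lemma orthonormal_communityVec (hc : Balanced c) (hn : 0 < n) : Orthonormal ℝ (communityVec c) := by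
  have hn' : (0 : ℝ) < n := by exact_mod_cast hn
  rw [orthonormal_iff_ite]
  intro a b
  have hk : (0 : ℝ) < k := by exact_mod_cast a.pos
  rw [inner_communityVec]
  split_ifs with h
  · subst h
    have h1 : ∑ j ∈ Finset.univ.filter (fun j => c j = a), communityVec c a j =
        communitySize c a * √((k : ℝ) / n) := by
      rw [Finset.sum_congr rfl (g := fun _ => √((k : ℝ) / n)), Finset.sum_const, nsmul_eq_mul]
      · rfl
      · intro j hj
        rw [communityVec_apply, if_pos (Finset.mem_filter.1 hj).2]
    have h2 : (k : ℝ) * communitySize c a = n := by exact_mod_cast hc a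
    rw [h1, mul_left_comm, Real.mul_self_sqrt (by positivity), ← h2]
    have : (communitySize c a : ℝ) ≠ 0 := fun h0 => by rw [h0, mul_zero] at h2; linarith
    field_simp
  · rw [Finset.sum_eq_zero, mul_zero]
    intro j hj
    rw [communityVec_apply, if_neg]
    rw [(Finset.mem_filter.1 hj).2]; exact h

lemma toEuclideanLin_blockMatrix (hn : 0 < n) (p q : ℝ) (w : EuclideanSpace ℝ (Fin n)) :
    Matrix.toEuclideanLin (blockMatrix c p q) w =
      ∑ a, ((n : ℝ) / k * ((p - q) * inner ℝ (communityVec c a) w +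
        q * ∑ b, inner ℝ (communityVec c b) w)) • communityVec c a := by
  ext i
  have hn' : (0 : ℝ) < n := by exact_mod_cast hn
  have hk : (0 : ℝ) < k := by exact_mod_cast (c i).pos
  rw [sum_smul_communityVec_apply]
  simp only [inner_communityVec]
  rw [← Finset.mul_sum, Finset.sum_fiberwise]
  have h1 : (Matrix.toEuclideanLin (blockMatrix c p q) w) i =
      (p - q) * ∑ j ∈ Finset.univ.filter (fun j => c j = c i), w j + q * ∑ j, w j := by
    simp only [Matrix.toLpLin_apply, Matrix.mulVec, dotProduct, blockMatrix,
      Matrix.of_apply, Finset.sum_filter, Finset.mul_sum, ← Finset.sum_add_distrib]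
    refine Finset.sum_congr rfl fun j _ => ?_
    by_cases h : c i = c j
    · simp [h]; ring
    · simp [h, Ne.symm h]
  rw [h1]
  have h2 : √((k : ℝ) / n) * √((k : ℝ) / n) = k / n := Real.mul_self_sqrt (by positivity)
  have h3 : (k : ℝ) / n * (n / k) = 1 := by field_simp
  linear_combination (-(n : ℝ) / k * ((p - q) * ∑ j ∈ Finset.univ.filter (fun j => c j = c i), w j
    + q * ∑ j, w j)) * h2 - ((p - q) * ∑ j ∈ Finset.univ.filter (fun j => c j = c i), w j
    + q * ∑ j, w j) * h3

lemma finrank_range_blockMatrix_le (hn : 0 < n) (p q : ℝ) :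
    Module.finrank ℝ (LinearMap.range (Matrix.toEuclideanLin (blockMatrix c p q))) ≤ k := by
  have h : LinearMap.range (Matrix.toEuclideanLin (blockMatrix c p q)) ≤
      Submodule.span ℝ (Set.range (communityVec c)) := by
    rintro _ ⟨w, rfl⟩
    rw [toEuclideanLin_blockMatrix hn]
    exact Submodule.sum_mem _ fun a _ =>
      Submodule.smul_mem _ _ (Submodule.subset_span ⟨a, rfl⟩)
  refine (Submodule.finrank_mono h).trans ?_
  simpa [Set.finrank] using finrank_range_le_card (R := ℝ) (communityVec c)

/-- On the span of the community vectors the block matrix has an inverse of norm at most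
`(n / k |p - q|)⁻¹`. -/
lemma exists_preimage_blockMatrix (hc : Balanced c) (hn : 0 < n) (hk : 2 ≤ k) {p q : ℝ}
    (hp : 0 < p) (hq : 0 < q) (hpq : p ≠ q) (x : Fin k → ℝ) :
    ∃ z, Matrix.toEuclideanLin (blockMatrix c p q) z = ∑ a, x a • communityVec c a ∧
      (n / k * |p - q|) * ‖z‖ ≤ ‖∑ a, x a • communityVec c a‖ := by
  have hn' : (0 : ℝ) < n := by exact_mod_cast hn
  have hk2 : (2 : ℝ) ≤ k := by exact_mod_cast hk
  have hk' : (0 : ℝ) < k := by linarith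
  have hV := orthonormal_communityVec hc hn
  have hD : p - q ≠ 0 := sub_ne_zero.2 hpq
  have hDk : 0 < p - q + k * q := by nlinarith
  set X := ∑ a, x a with hX
  -- On coefficients the block matrix is `n / k` times `(p - q) I + q J` with the all-ones matrix
  -- `J`; `t` comes from the Sherman-Morrison inverse.
  set t := q / (p - q + k * q) with ht
  have ht0 : 0 ≤ t := by positivity
  have hts : t * (p - q + k * q) = q := div_mul_cancel₀ q hDk.ne'
  -- Amounts to `0 ≤ 2 p + (k - 2) q`, hence the need for `2 ≤ k`. It makes `x ↦ x - t X` a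
  -- contraction, since it lowers the sum of squares by `t (2 - k t) X ^ 2`.
  have hkt : k * t ≤ 2 := by
    rw [ht, ← mul_div_assoc, div_le_iff₀ hDk]; nlinarith
  let y : Fin k → ℝ := fun a => (x a - t * X) / (n / k * (p - q))
  have hnorm : ∀ x : Fin k → ℝ, ‖∑ a, x a • communityVec c a‖ ^ 2 = ∑ a, x a ^ 2 := fun x => by
    rw [← real_inner_self_eq_norm_sq, hV.inner_sum]
    exact Finset.sum_congr rfl fun j _ => by simp [sq]
  have hcoef : ∀ a, (n / k * (p - q)) * y a = x a - t * X := fun a => by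
    simp only [y]; field_simp
  have hsumx : ∑ a, (x a - t * X) = X - k * (t * X) := by
    rw [Finset.sum_sub_distrib, ← hX]; simp
  refine ⟨∑ a, y a • communityVec c a, ?_, ?_⟩
  · rw [toEuclideanLin_blockMatrix hn]
    simp only [hV.inner_right_fintype]
    refine Finset.sum_congr rfl fun a _ => ?_
    congr 1
    have h1 : (n / k * (p - q)) * ∑ b, y b = X - k * (t * X) := by
      rw [Finset.mul_sum, Finset.sum_congr rfl fun b _ => hcoef b, hsumx]
    have h2 := hcoef a
    have h4 : (p - q) * (n / k * q * ∑ b, y b) = (p - q) * (t * X) := by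
      have : q - t * (k * q) = t * (p - q) := by linear_combination -hts
      linear_combination q * h1 + X * this
    have h5 := mul_left_cancel₀ hD h4
    linear_combination h2 + h5
  · refine le_of_sq_le_sq ?_ (norm_nonneg _)
    rw [mul_pow, hnorm, hnorm, Finset.mul_sum]
    have h1 : ∀ a, (n / k * |p - q|) ^ 2 * y a ^ 2 = x a ^ 2 - 2 * t * X * x a + t ^ 2 * X ^ 2 :=
      fun a => by
        rw [mul_pow, sq_abs, ← mul_pow, ← mul_pow, hcoef]; ring
    rw [Finset.sum_congr rfl fun a _ => h1 a, Finset.sum_add_distrib, Finset.sum_sub_distrib,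
      ← Finset.mul_sum, ← hX]
    simp only [Finset.sum_const, Finset.card_univ, Fintype.card_fin, nsmul_eq_mul]
    nlinarith [mul_nonneg (mul_nonneg ht0 (sub_nonneg.2 hkt)) (sq_nonneg X)]

/-! ### Spectral clustering of a perturbed block matrix -/

/-- Read by columns, the cost is the sum of squared distances of the `U j` from the span of the
community vectors. For two orthonormal `k`-frames this is symmetric: both sides are `k` minus the
sum of all squared inner products. -/
lemma kmeansCost_spectralRow (hV : Orthonormal ℝ (communityVec c))
    {U : Fin k → EuclideanSpace ℝ (Fin n)} (hU : Orthonormal ℝ U) :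
    kmeansCost (spectralRow U) c
      (fun a => √((k : ℝ) / n) • WithLp.toLp 2 fun j => inner ℝ (U j) (communityVec c a)) =
      ∑ a, ‖residual U (communityVec c a)‖ ^ 2 := by
  have h1 : ∀ j, ∑ i, (U j i - √((k : ℝ) / n) * inner ℝ (U j) (communityVec c (c i))) ^ 2 =
      1 - ∑ a, inner ℝ (U j) (communityVec c a) ^ 2 := fun j => by
    have h := norm_sq_residual hV (U j)
    rw [hU.norm_eq_one, one_pow, EuclideanSpace.norm_sq_eq] at h
    simp only [real_inner_comm (communityVec c _)]
    rw [← h]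
    refine Finset.sum_congr rfl fun i _ => ?_
    rw [Real.norm_eq_abs, sq_abs, residual, PiLp.sub_apply, sum_smul_communityVec_apply]
  simp only [kmeansCost, EuclideanSpace.norm_sq_eq, spectralRow]
  rw [Finset.sum_comm]
  simp only [PiLp.sub_apply, PiLp.smul_apply, smul_eq_mul, Real.norm_eq_abs, sq_abs, h1]
  have h2 : ∀ a, ∑ i, (residual U (communityVec c a) i) ^ 2 =
      1 - ∑ j, inner ℝ (U j) (communityVec c a) ^ 2 := fun a => by
    have h := norm_sq_residual hU (communityVec c a)
    rw [hV.norm_eq_one, one_pow, EuclideanSpace.norm_sq_eq] at h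
    simpa using h
  simp only [h2, Finset.sum_sub_distrib]
  rw [Finset.sum_comm]

/-- Spectral clustering of a matrix that is `δ`-close to the block matrix. -/
theorem misclusteringError_le_of_close (hc : Balanced c) (hn : 0 < n) (hk : 2 ≤ k) {p q : ℝ}
    (hp : 0 < p) (hq : 0 < q) (hpq : p ≠ q) {A : Matrix (Fin n) (Fin n) ℝ} (hA : A.IsHermitian)
    {δ : ℝ} (hδ0 : 0 ≤ δ)
    (hδ : ∀ w, ‖Matrix.toEuclideanLin (A - blockMatrix c p q) w‖ ≤ δ * ‖w‖)
    {ε : ℝ} (hε : 0 < ε) {z : Fin n → Fin k} (hz : IsSpectralClustering ε A z) :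
    misclusteringError c z ≤ 64 * (2 + ε) * (δ / (n / k * |p - q|)) ^ 2 := by
  have hn' : (0 : ℝ) < n := by exact_mod_cast hn
  have hk2 : (2 : ℝ) ≤ k := by exact_mod_cast hk
  have hk' : (0 : ℝ) < k := by linarith
  have hD : p - q ≠ 0 := sub_ne_zero.2 hpq
  set L := n / k * |p - q| with hL
  have hL0 : 0 < L := by positivity
  set τ := (δ / L) ^ 2 with hτ
  have hτ0 : 0 ≤ τ := sq_nonneg _
  -- For `τ ≥ 1 / 8` the claimed bound exceeds `1`; otherwise the centers are separated.
  rcases le_or_gt (1 / 8) τ with hbig | hsmall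
  · refine (misclusteringError_le_one c z).trans ?_
    nlinarith
  have hV := orthonormal_communityVec hc hn
  obtain ⟨U, ⟨hU, lam, hlam, hlead⟩, M, hM⟩ := hz
  have hsymm : (Matrix.toEuclideanLin A).IsSymmetric := Matrix.isSymmetric_toEuclideanLin_iff.2 hA
  have hclose : ∀ w, ‖Matrix.toEuclideanLin A w - Matrix.toEuclideanLin (blockMatrix c p q) w‖ ≤
      δ * ‖w‖ := fun w => by
    rw [← LinearMap.sub_apply, ← map_sub]; exact hδ w
  have hres : ∀ x : Fin k → ℝ, ‖residual U (∑ a, x a • communityVec c a)‖ ^ 2 ≤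
      4 * τ * ‖∑ a, x a • communityVec c a‖ ^ 2 := fun x => by
    obtain ⟨w, hw, hwn⟩ := exists_preimage_blockMatrix hc hn hk hp hq hpq x
    have h1 := norm_residual_le_of_leading hU hsymm hlam hlead
      (finrank_range_blockMatrix_le hn p q) hδ0 hclose w
    rw [hw] at h1
    have h2 : ‖residual U (∑ a, x a • communityVec c a)‖ ≤
        2 * (δ / L) * ‖∑ a, x a • communityVec c a‖ := by
      refine h1.trans ?_
      calc 2 * δ * ‖w‖ = 2 * (δ / L) * (L * ‖w‖) := by field_simp
        _ ≤ _ := by gcongr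
    calc _ ≤ (2 * (δ / L) * ‖∑ a, x a • communityVec c a‖) ^ 2 :=
          pow_le_pow_left₀ (norm_nonneg _) h2 2
      _ = _ := by rw [hτ]; ring
  have hsingle : ∀ a, ∑ b, (Pi.single a (1 : ℝ) : Fin k → ℝ) b • communityVec c b =
      communityVec c a := fun a => by
    rw [Finset.sum_eq_single a] <;> simp +contextual
  let m : Fin k → EuclideanSpace ℝ (Fin k) := fun a =>
    √((k : ℝ) / n) • WithLp.toLp 2 fun j => inner ℝ (U j) (communityVec c a)
  have hη : kmeansCost (spectralRow U) c m ≤ k * (4 * τ) := by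
    rw [kmeansCost_spectralRow hV hU]
    have : ∀ a ∈ Finset.univ, ‖residual U (communityVec c a)‖ ^ 2 ≤ 4 * τ := fun a _ => by
      have h := hres (Pi.single a 1)
      rw [hsingle, hV.norm_eq_one] at h
      linarith
    simpa using Finset.sum_le_card_nsmul _ _ _ this
  -- The difference of two community vectors has squared norm `2`, of which the projection to the
  -- span of `U` loses at most `8 τ < 1`.
  have hsep : ∀ a b, a ≠ b → (k : ℝ) / n ≤ ‖m a - m b‖ ^ 2 := by
    intro a b hab
    have h0 : ∑ e, (Pi.single a 1 - Pi.single b 1 : Fin k → ℝ) e • communityVec c e =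
        communityVec c a - communityVec c b := by
      simp only [Pi.sub_apply, sub_smul, Finset.sum_sub_distrib, hsingle]
    have h1 := hres (Pi.single a 1 - Pi.single b 1)
    rw [h0, norm_sq_residual hU] at h1
    have h2 : ‖communityVec c a - communityVec c b‖ ^ 2 = 2 := by
      rw [norm_sub_sq_real, hV.norm_eq_one, hV.norm_eq_one, hV.inner_eq_zero hab]; norm_num
    have h3 : ‖m a - m b‖ ^ 2 =
        k / n * ∑ j, inner ℝ (U j) (communityVec c a - communityVec c b) ^ 2 := by
      rw [EuclideanSpace.norm_sq_eq, Finset.mul_sum]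
      refine Finset.sum_congr rfl fun j _ => ?_
      simp only [m, PiLp.sub_apply, PiLp.smul_apply, smul_eq_mul, Real.norm_eq_abs, sq_abs,
        inner_sub_right]
      rw [← mul_sub, mul_pow, Real.sq_sqrt (by positivity)]
    rw [h3]
    refine le_mul_of_one_le_right (by positivity) ?_
    rw [h2] at h1
    linarith
  refine (misclusteringError_le_of_kmeans hc hε (by positivity) hsep hη (hM c m)).trans ?_
  refine le_of_eq ?_
  field_simp
  ring

end Model


/-! ### Traces of powers of symmetric matrices -/

lemma trace_pow_eq_sum_eigenvalues {n : ℕ} {M : Matrix (Fin n) (Fin n) ℝ}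
    (h : (Matrix.toEuclideanLin M).IsSymmetric) (m : ℕ) :
    (M ^ m).trace = ∑ i, h.eigenvalues finrank_euclideanSpace_fin i ^ m := by
  have h1 : (M ^ m).trace = LinearMap.trace ℝ _ ((Matrix.toEuclideanLin M) ^ m) := by
    have : (Matrix.toEuclideanLin M) ^ m = Matrix.toEuclideanLin (M ^ m) := by
      induction m with
      | zero => ext; simp
      | succ m ih => rw [pow_succ, ih, pow_succ]; ext; simp
    rw [this, Matrix.toEuclideanLin_eq_toLin_orthonormal]
    exact (Matrix.trace_toLin_eq _ _).symm
  rw [h1, LinearMap.trace_eq_sum_inner _ (h.eigenvectorBasis finrank_euclideanSpace_fin)]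
  refine Finset.sum_congr rfl fun i _ => ?_
  have h2 : ((Matrix.toEuclideanLin M) ^ m) (h.eigenvectorBasis finrank_euclideanSpace_fin i) =
      h.eigenvalues finrank_euclideanSpace_fin i ^ m •
        h.eigenvectorBasis finrank_euclideanSpace_fin i := by
    clear h1
    induction m with
    | zero => simp
    | succ m ih =>
      rw [pow_succ', Module.End.mul_apply, ih, map_smul, h.apply_eigenvectorBasis, smul_smul,
        pow_succ]
      rfl
  rw [h2, inner_smul_right, real_inner_self_eq_norm_sq, OrthonormalBasis.norm_eq_one]
  simp

/-- Even powers make all terms of the trace nonnegative, so it dominates the `2 p`-th power of each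
eigenvalue. -/
lemma norm_toEuclideanLin_le_of_trace_pow_le {n : ℕ} {M : Matrix (Fin n) (Fin n) ℝ}
    (hM : M.IsHermitian) {p : ℕ} (hp : p ≠ 0) {B : ℝ} (hB : 0 ≤ B)
    (h : (M ^ (2 * p)).trace ≤ B ^ p) (w : EuclideanSpace ℝ (Fin n)) :
    ‖Matrix.toEuclideanLin M w‖ ≤ √B * ‖w‖ := by
  have hs : (Matrix.toEuclideanLin M).IsSymmetric := Matrix.isSymmetric_toEuclideanLin_iff.2 hM
  refine norm_map_le_of_eigenvalues hs finrank_euclideanSpace_fin (fun i => ?_) w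
  refine Real.abs_le_sqrt ?_
  rw [trace_pow_eq_sum_eigenvalues hs] at h
  refine le_of_pow_le_pow_left₀ hp hB (le_trans ?_ h)
  rw [← pow_mul]
  exact Finset.single_le_sum (f := fun i => hs.eigenvalues finrank_euclideanSpace_fin i ^ (2 * p))
    (fun j _ => (even_two_mul p).pow_nonneg _) (Finset.mem_univ i)

lemma trace_pow_le_of_norm_le {n : ℕ} {M : Matrix (Fin n) (Fin n) ℝ}
    (hM : M.IsHermitian) (p : ℕ) {B : ℝ}
    (h : ∀ w, ‖Matrix.toEuclideanLin M w‖ ≤ B * ‖w‖) :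
    (M ^ (2 * p)).trace ≤ n * B ^ (2 * p) := by
  have hs : (Matrix.toEuclideanLin M).IsSymmetric := Matrix.isSymmetric_toEuclideanLin_iff.2 hM
  rw [trace_pow_eq_sum_eigenvalues hs]
  have : ∀ i ∈ Finset.univ, hs.eigenvalues finrank_euclideanSpace_fin i ^ (2 * p) ≤ B ^ (2 * p) := by
    intro i _
    have h1 := h (hs.eigenvectorBasis finrank_euclideanSpace_fin i)
    rw [hs.apply_eigenvectorBasis, norm_smul, OrthonormalBasis.norm_eq_one, mul_one, mul_one] at h1
    rw [← (even_two_mul p).pow_abs]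
    exact pow_le_pow_left₀ (abs_nonneg _) (by simpa using h1) _
  simpa using Finset.sum_le_card_nsmul _ _ _ this

/-! ### Closed walks -/

lemma pow_apply_eq_sum_walks {ι : Type*} [Fintype ι] [DecidableEq ι] (M : Matrix ι ι ℝ) (m : ℕ)
    (i j : ι) : (M ^ m) i j = ∑ w : Fin (m + 1) → ι,
      if w 0 = i ∧ w (Fin.last m) = j then ∏ s : Fin m, M (w s.castSucc) (w s.succ) else 0 := by
  induction m generalizing i with
  | zero =>
    rw [← (Equiv.funUnique (Fin 1) ι).symm.sum_comp]
    simp only [pow_zero, Matrix.one_apply, Finset.univ_eq_empty, Finset.prod_empty]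
    by_cases h : i = j
    · subst h
      rw [Finset.sum_eq_single i] <;> simp +contextual [Equiv.funUnique, uniqueElim_const]
    · rw [if_neg h, Finset.sum_eq_zero]
      intro a _
      rw [if_neg]
      rintro ⟨h1, h2⟩
      exact h (h1.symm.trans h2)
  | succ m ih =>
    rw [pow_succ', Matrix.mul_apply, ← (Fin.consEquiv fun _ => ι).sum_comp, Fintype.sum_prod_type]
    simp only [Fin.consEquiv_apply, Fin.cons_zero, ← Fin.succ_last, Fin.cons_succ,
      Fin.prod_univ_succ, Fin.castSucc_zero, ← Fin.succ_castSucc]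
    symm
    rw [Finset.sum_eq_single i]
    · symm
      simp only [ih, Finset.mul_sum, true_and]
      rw [Finset.sum_comm]
      refine Finset.sum_congr rfl fun w _ => ?_
      rw [Finset.sum_eq_single (w 0)]
      · simp
      · intro b _ hb
        rw [if_neg fun h => hb h.1.symm, mul_zero]
      · simp
    · intro b _ hb
      exact Finset.sum_eq_zero fun w _ => if_neg fun h => hb h.1
    · simp

lemma trace_pow_eq_sum_closed_walks {ι : Type*} [Fintype ι] [DecidableEq ι] (M : Matrix ι ι ℝ)
    (m : ℕ) : (M ^ m).trace = ∑ w : Fin (m + 1) → ι,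
      if w 0 = w (Fin.last m) then ∏ s : Fin m, M (w s.castSucc) (w s.succ) else 0 := by
  simp only [Matrix.trace, Matrix.diag_apply, pow_apply_eq_sum_walks]
  rw [Finset.sum_comm]
  refine Finset.sum_congr rfl fun w _ => ?_
  rw [Finset.sum_eq_single (w 0)]
  · simp [eq_comm]
  · intro b _ hb
    rw [if_neg fun h => hb h.1.symm]
  · simp

/-- The edge used in step `s` of the walk `w`. -/
def walkEdge {ι : Type*} {m : ℕ} (w : Fin (m + 1) → ι) (s : Fin m) : Sym2 ι :=
  s(w s.castSucc, w s.succ)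

/-- Closed walks that use none of their edges exactly once. -/
def IsDoubledWalk {ι : Type*} {m : ℕ} (w : Fin (m + 1) → ι) : Prop :=
  w 0 = w (Fin.last m) ∧ ∀ s, ∃ t, t ≠ s ∧ walkEdge w t = walkEdge w s

/-- The property depends only on which times visit a common vertex. This allows comparing walks on
vertex sets of different sizes. -/
lemma IsDoubledWalk.of_kernel_eq {ι κ : Type*} {m : ℕ} {w : Fin (m + 1) → ι} {w' : Fin (m + 1) → κ}
    (h : ∀ s t, w s = w t ↔ w' s = w' t) (hw : IsDoubledWalk w) : IsDoubledWalk w' := by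
  refine ⟨(h _ _).1 hw.1, fun s => ?_⟩
  obtain ⟨t, hts, ht⟩ := hw.2 s
  refine ⟨t, hts, ?_⟩
  simp only [walkEdge, Sym2.eq_iff] at ht ⊢
  simpa only [h] using ht

/-- Along the walk, a new vertex is always reached through a new edge. -/
lemma card_vertices_le_card_edges {ι : Type*} [DecidableEq ι] {m : ℕ} (w : Fin (m + 1) → ι) :
    (Finset.univ.image w).card ≤ (Finset.univ.image (walkEdge w)).card + 1 := by
  induction m with
  | zero => exact Finset.card_image_le.trans (by simp)
  | succ m ih =>
    let w' : Fin (m + 1) → ι := fun s => w s.castSucc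
    have h1 : Finset.univ.image w = insert (w (Fin.last _)) (Finset.univ.image w') := by
      ext a
      simp only [Finset.mem_image, Finset.mem_univ, true_and, Finset.mem_insert, w']
      constructor
      · rintro ⟨s, rfl⟩
        induction s using Fin.lastCases with
        | last => exact Or.inl rfl
        | cast s => exact Or.inr ⟨s, rfl⟩
      · rintro (rfl | ⟨s, rfl⟩)
        exacts [⟨_, rfl⟩, ⟨_, rfl⟩]
    have h2 : Finset.univ.image (walkEdge w) =
        insert (walkEdge w (Fin.last m)) (Finset.univ.image (walkEdge w')) := by
      ext a
      simp only [Finset.mem_image, Finset.mem_univ, true_and, Finset.mem_insert]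
      constructor
      · rintro ⟨s, rfl⟩
        induction s using Fin.lastCases with
        | last => exact Or.inl rfl
        | cast s => exact Or.inr ⟨s, rfl⟩
      · rintro (rfl | ⟨s, rfl⟩)
        exacts [⟨_, rfl⟩, ⟨s.castSucc, rfl⟩]
    rw [h1, h2]
    by_cases hmem : w (Fin.last _) ∈ Finset.univ.image w'
    · rw [Finset.insert_eq_of_mem hmem]
      refine (ih w').trans ?_
      gcongr
      exact Finset.subset_insert _ _
    · rw [Finset.card_insert_of_notMem hmem, Finset.card_insert_of_notMem]
      · exact Nat.add_le_add_right (ih w') 1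
      · intro hedge
        obtain ⟨s, -, hs⟩ := Finset.mem_image.1 hedge
        have hin : w (Fin.last _) ∈ walkEdge w' s := by
          rw [hs, walkEdge, Fin.succ_last]; exact Sym2.mem_mk_right _ _
        rcases Sym2.mem_iff.1 hin with h | h <;>
        exact hmem (Finset.mem_image.2 ⟨_, Finset.mem_univ _, h.symm⟩)

/-- Every edge takes at least two of the `m` steps. For `m = 2 p` this leaves at most `p` edges,
hence at most `p + 1` vertices. -/
lemma two_mul_card_edges_le {ι : Type*} [DecidableEq ι] {m : ℕ} {w : Fin (m + 1) → ι}
    (hw : IsDoubledWalk w) : 2 * (Finset.univ.image (walkEdge w)).card ≤ m := by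
  have h : ∀ e ∈ Finset.univ.image (walkEdge w),
      2 ≤ (Finset.univ.filter fun s => walkEdge w s = e).card := by
    intro e he
    obtain ⟨s, -, rfl⟩ := Finset.mem_image.1 he
    obtain ⟨t, hts, ht⟩ := hw.2 s
    exact Finset.one_lt_card.2 ⟨t, by simpa using ht, s, by simp, hts⟩
  simpa using Finset.mul_card_image_le_card Finset.univ 2 h

/-- The number of functions with the same kernel as `w`. -/
lemma card_filter_kernel_eq {α ι : Type*} [Fintype α] [Fintype ι] [DecidableEq α] [DecidableEq ι]
    (w : α → ι) (N : ℕ) :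
    (Finset.univ.filter fun w' : α → Fin N => ∀ s t, w s = w t ↔ w' s = w' t).card =
      N.descFactorial (Finset.univ.image w).card := by
  classical
  have h1 : Fintype.card (Set.range w) = (Finset.univ.image w).card := by
    rw [← Set.toFinset_card, Set.toFinset_range]
  rw [← h1, ← Fintype.card_fin N, ← Fintype.card_embedding_eq, Fintype.card_fin,
    ← Finset.card_univ]
  symm
  refine Finset.card_bij (fun f _ s => f ⟨w s, s, rfl⟩) ?_ ?_ ?_
  · intro f _
    exact Finset.mem_filter.2 ⟨Finset.mem_univ _, fun s t =>
      ⟨fun h => by simp only [h], fun h => congrArg Subtype.val (f.injective h)⟩⟩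
  · intro f _ g _ h
    ext ⟨_, s, rfl⟩
    exact congrArg Fin.val (congrFun h s)
  · intro w' hw'
    simp only [Finset.mem_filter, Finset.mem_univ, true_and] at hw'
    refine ⟨⟨fun a => w' a.2.choose, fun a b hab => ?_⟩, Finset.mem_univ _, ?_⟩
    · have h := (hw' _ _).2 hab
      rw [a.2.choose_spec, b.2.choose_spec] at h
      exact Subtype.ext h
    · funext s
      exact (hw' _ _).1 (Exists.choose_spec (⟨s, rfl⟩ : ∃ t, w t = w s))

open Classical in
/-- Comparison of weighted doubled closed walks on `n` vertices with unweighted ones on `2 p + 1`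
vertices. -/
lemma sum_doubled_walks_le (n p : ℕ) {q : ℝ} (hq0 : 0 ≤ q) (hnq : n * q ≤ p) :
    ∑ w : Fin (2 * p + 1) → Fin n, (if IsDoubledWalk w then
      q ^ ((Finset.univ.image w).card - 1) else 0) ≤
    n * (Finset.univ.filter fun w : Fin (2 * p + 1) → Fin (2 * p + 1) =>
      IsDoubledWalk w).card := by
  -- The pattern of coincidences, coded by a type independent of `N`, so that both families of walks
  -- can be sorted by it.
  let κ : ∀ {N : ℕ}, (Fin (2 * p + 1) → Fin N) → Finset (Fin (2 * p + 1) × Fin (2 * p + 1)) :=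
    fun w => Finset.univ.filter fun st => w st.1 = w st.2
  have hκ : ∀ {N N' : ℕ} (w : Fin (2 * p + 1) → Fin N) (w' : Fin (2 * p + 1) → Fin N'),
      κ w' = κ w ↔ ∀ s t, w s = w t ↔ w' s = w' t := by
    intro N N' w w'
    simp only [κ, Finset.ext_iff, Finset.mem_filter, Finset.mem_univ, true_and, Prod.forall]
    exact forall₂_congr fun _ _ => Iff.comm
  have hcardv : ∀ {N : ℕ} (w w' : Fin (2 * p + 1) → Fin N), κ w' = κ w →
      (Finset.univ.image w').card = (Finset.univ.image w).card := by
    intro N w w' h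
    rw [hκ] at h
    have hl : ∀ w₁ w₂ : Fin (2 * p + 1) → Fin N, (∀ s t, w₁ s = w₁ t ↔ w₂ s = w₂ t) →
        (Finset.univ.image w₁).card ≤ (Finset.univ.image w₂).card := by
      intro w₁ w₂ h
      refine Finset.card_le_card_of_injOn (fun a => if ha : ∃ s, w₁ s = a then w₂ ha.choose else a)
        ?_ ?_
      · intro a ha
        obtain ⟨s, -, hs⟩ := Finset.mem_image.1 ha
        have hex : ∃ s, w₁ s = a := ⟨s, hs⟩
        simp [hex]
      · intro a ha b hb hab
        obtain ⟨s, -, hs⟩ := Finset.mem_image.1 ha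
        obtain ⟨t, -, ht⟩ := Finset.mem_image.1 hb
        have hexa : ∃ s, w₁ s = a := ⟨s, hs⟩
        have hexb : ∃ s, w₁ s = b := ⟨t, ht⟩
        simp only [hexa, hexb, dif_pos] at hab
        rw [← hexa.choose_spec, ← hexb.choose_spec]
        exact (h _ _).2 hab
    exact le_antisymm (hl _ _ fun s t => (h s t).symm) (hl _ _ h)
  let Gn : Finset (Fin (2 * p + 1) → Fin n) := Finset.univ.filter fun w => IsDoubledWalk w
  let Gr : Finset (Fin (2 * p + 1) → Fin (2 * p + 1)) :=
    Finset.univ.filter fun w => IsDoubledWalk w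
  -- Compares the sizes of one class on both vertex sets. With at most `p + 1` vertices, the falling
  -- factorial of `2 p + 1` is at least `(2 p + 2 - v) ^ v ≥ (p + 1) ^ v`, while `n ^ v q ^ (v - 1)
  -- = n (n q) ^ (v - 1)` with `n q ≤ p`.
  have hdesc : ∀ v, v ≤ p + 1 → 1 ≤ v →
      (n.descFactorial v : ℝ) * q ^ (v - 1) ≤ n * (2 * p + 1).descFactorial v := by
    intro v hv hv1
    have h1 : (n.descFactorial v : ℝ) ≤ n ^ v := by exact_mod_cast Nat.descFactorial_le_pow n v
    have h2 : ((p : ℝ) + 1) ^ v ≤ ((2 * p + 1).descFactorial v : ℝ) := by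
      have h3 : (p + 1) ^ v ≤ (2 * p + 1).descFactorial v :=
        (Nat.pow_le_pow_left (by omega) v).trans (Nat.pow_sub_le_descFactorial (2 * p + 1) v)
      exact_mod_cast h3
    obtain ⟨u, rfl⟩ : ∃ u, v = u + 1 := ⟨v - 1, by omega⟩
    calc (n.descFactorial (u + 1) : ℝ) * q ^ (u + 1 - 1) ≤ n ^ (u + 1) * q ^ u := by
          rw [Nat.add_sub_cancel]; gcongr
      _ = n * (n * q) ^ u := by rw [mul_pow]; ring
      _ ≤ n * ((p : ℝ) + 1) ^ (u + 1) := by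
          have h4 : (n * q) ^ u ≤ ((p : ℝ) + 1) ^ u :=
            pow_le_pow_left₀ (by positivity) (by linarith) u
          have h5 : ((p : ℝ) + 1) ^ u ≤ ((p : ℝ) + 1) ^ (u + 1) :=
            pow_le_pow_right₀ (by linarith [(Nat.cast_nonneg p : (0 : ℝ) ≤ p)]) (by omega)
          gcongr
          exact h4.trans h5
      _ ≤ _ := by gcongr
  calc ∑ w : Fin (2 * p + 1) → Fin n, (if IsDoubledWalk w then
      q ^ ((Finset.univ.image w).card - 1) else 0)
      = ∑ w ∈ Gn, q ^ ((Finset.univ.image w).card - 1) := (Finset.sum_filter _ _).symm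
    _ = ∑ e ∈ Gn.image κ, ∑ w ∈ Gn.filter (fun w => κ w = e),
          q ^ ((Finset.univ.image w).card - 1) :=
        (Finset.sum_fiberwise_of_maps_to (fun w hw => Finset.mem_image_of_mem _ hw) _).symm
    _ ≤ ∑ e ∈ Gn.image κ, (n : ℝ) * (Gr.filter fun w => κ w = e).card := by
        refine Finset.sum_le_sum fun e he => ?_
        obtain ⟨w₀, hw₀, rfl⟩ := Finset.mem_image.1 he
        have hw₀' : IsDoubledWalk w₀ := (Finset.mem_filter.1 hw₀).2
        have hclass : ∀ N, (Finset.univ.filter fun w : Fin (2 * p + 1) → Fin N =>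
            IsDoubledWalk w).filter (fun w => κ w = κ w₀) =
            Finset.univ.filter fun w => ∀ s t, w₀ s = w₀ t ↔ w s = w t := by
          intro N
          ext w
          simp only [Finset.mem_filter, Finset.mem_univ, true_and, hκ]
          exact ⟨fun h => h.2, fun h => ⟨hw₀'.of_kernel_eq h, h⟩⟩
        rw [Finset.sum_congr rfl fun w hw => by
          rw [hcardv w₀ w (Finset.mem_filter.1 hw).2], Finset.sum_const, nsmul_eq_mul]
        have hcard : ∀ N, ((Finset.univ.filter fun w : Fin (2 * p + 1) → Fin N =>
            IsDoubledWalk w).filter (fun w => κ w = κ w₀)).card =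
            N.descFactorial (Finset.univ.image w₀).card := fun N => by
          rw [hclass]
          convert card_filter_kernel_eq w₀ N
        simp only [Gn, Gr]
        rw [hcard, hcard]
        have hv := card_vertices_le_card_edges w₀
        have he2 := two_mul_card_edges_le hw₀'
        have hv1 : 1 ≤ (Finset.univ.image w₀).card :=
          Finset.card_pos.2 ⟨w₀ 0, Finset.mem_image_of_mem _ (Finset.mem_univ _)⟩
        exact hdesc _ (by omega) hv1
    _ = n * ∑ e ∈ Gn.image κ, ((Gr.filter fun w => κ w = e).card : ℝ) := by
        rw [Finset.mul_sum]
    _ ≤ n * Gr.card := by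
        gcongr
        rw [← Nat.cast_sum, Finset.sum_card_fiberwise_eq_card_filter]
        exact_mod_cast Finset.card_filter_le _ _


/-! ### Expected traces of random symmetric matrices -/

/-- The symmetric matrix with entry `x s(i, j)` at `(i, j)`. -/
def symMatrix {n : ℕ} (x : Sym2 (Fin n) → ℝ) : Matrix (Fin n) (Fin n) ℝ :=
  Matrix.of fun i j => x s(i, j)

lemma symMatrix_isHermitian {n : ℕ} (x : Sym2 (Fin n) → ℝ) : (symMatrix x).IsHermitian := by
  ext i j
  simp [symMatrix, Sym2.eq_swap]

/-- The number of times that the walk `w` uses the edge `e`. -/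
def walkMult {n m : ℕ} (w : Fin (m + 1) → Fin n) (e : Sym2 (Fin n)) : ℕ :=
  (Finset.univ.filter fun s => walkEdge w s = e).card

/-- Collecting equal entries turns each walk into a monomial in the edge variables, whose
expectation factors. -/
lemma trace_pow_symMatrix {n : ℕ} (x : Sym2 (Fin n) → ℝ) (m : ℕ) :
    (symMatrix x ^ m).trace = ∑ w : Fin (m + 1) → Fin n,
      if w 0 = w (Fin.last m) then ∏ e, x e ^ walkMult w e else 0 := by
  rw [trace_pow_eq_sum_closed_walks]
  refine Finset.sum_congr rfl fun w _ => ?_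
  congr 1
  calc ∏ s : Fin m, symMatrix x (w s.castSucc) (w s.succ) = ∏ s : Fin m, x (walkEdge w s) := rfl
    _ = ∏ e, ∏ s ∈ Finset.univ.filter (fun s => walkEdge w s = e), x (walkEdge w s) :=
        (Finset.prod_fiberwise _ _ _).symm
    _ = _ := Finset.prod_congr rfl fun e _ => by
        rw [Finset.prod_congr rfl (g := fun _ => x e) fun s hs => by
          rw [(Finset.mem_filter.1 hs).2], Finset.prod_const]
        rfl

lemma walkMult_of_isDoubledWalk {n m : ℕ} {w : Fin (m + 1) → Fin n} (hw : IsDoubledWalk w)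
    (e : Sym2 (Fin n)) : walkMult w e = 0 ∧ e ∉ Finset.univ.image (walkEdge w) ∨
      2 ≤ walkMult w e ∧ e ∈ Finset.univ.image (walkEdge w) := by
  by_cases he : e ∈ Finset.univ.image (walkEdge w)
  · refine Or.inr ⟨?_, he⟩
    obtain ⟨s, -, rfl⟩ := Finset.mem_image.1 he
    obtain ⟨t, hts, ht⟩ := hw.2 s
    exact Finset.one_lt_card.2 ⟨t, by simpa using ht, s, by simp, hts⟩
  · refine Or.inl ⟨?_, he⟩
    refine Finset.card_eq_zero.2 (Finset.filter_eq_empty_iff.2 fun s _ hs => he ?_)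
    exact Finset.mem_image.2 ⟨s, Finset.mem_univ _, hs⟩

lemma exists_walkMult_eq_one {n m : ℕ} {w : Fin (m + 1) → Fin n} (hw : ¬ IsDoubledWalk w)
    (hcl : w 0 = w (Fin.last m)) : ∃ e, walkMult w e = 1 := by
  simp only [IsDoubledWalk, hcl, true_and, not_forall, not_exists, not_and] at hw
  obtain ⟨s, hs⟩ := hw
  refine ⟨walkEdge w s, Finset.card_eq_one.2 ⟨s, ?_⟩⟩
  ext t
  simp only [Finset.mem_filter, Finset.mem_univ, true_and, Finset.mem_singleton]
  refine ⟨fun h => ?_, fun h => by rw [h]⟩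
  by_contra hne
  exact hs t hne h

section Expectation

variable {Ω : Type*} [MeasurableSpace Ω] {P : Measure Ω}

/-- All mixed moments of the family exist and factor, as for bounded independent variables. -/
structure MomentsFactor {κ : Type*} [Fintype κ] (P : Measure Ω) (x : κ → Ω → ℝ) : Prop where
  integrable : ∀ k : κ → ℕ, Integrable (fun ω => ∏ e, x e ω ^ k e) P
  integral : ∀ k : κ → ℕ, ∫ ω, ∏ e, x e ω ^ k e ∂P = ∏ e, ∫ ω, x e ω ^ k e ∂P

lemma MomentsFactor.integrable_trace {n : ℕ} {x : Sym2 (Fin n) → Ω → ℝ} (hx : MomentsFactor P x)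
    (m : ℕ) : Integrable (fun ω => (symMatrix (fun e => x e ω) ^ m).trace) P := by
  simp only [trace_pow_symMatrix]
  refine integrable_finsetSum _ fun w _ => ?_
  split_ifs
  · exact hx.integrable _
  · exact integrable_zero _ _ _

lemma MomentsFactor.integral_trace {n : ℕ} {x : Sym2 (Fin n) → Ω → ℝ} (hx : MomentsFactor P x)
    (m : ℕ) : ∫ ω, (symMatrix (fun e => x e ω) ^ m).trace ∂P = ∑ w : Fin (m + 1) → Fin n,
      if w 0 = w (Fin.last m) then ∏ e, ∫ ω, x e ω ^ walkMult w e ∂P else 0 := by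
  simp only [trace_pow_symMatrix]
  rw [integral_finsetSum]
  · refine Finset.sum_congr rfl fun w _ => ?_
    split_ifs
    · exact hx.integral _
    · simp
  · intro w _
    split_ifs
    · exact hx.integrable _
    · exact integrable_zero _ _ _

variable [IsProbabilityMeasure P]

open Classical in
-- An edge used exactly once contributes its mean `0`. On the other closed walks each used edge
-- contributes at most `q ≤ 1`, and there are at least as many edges as vertices minus one.
lemma MomentsFactor.integral_trace_le {n p : ℕ} {x : Sym2 (Fin n) → Ω → ℝ}
    (hx : MomentsFactor P x) {q : ℝ} (hq0 : 0 ≤ q) (hq1 : q ≤ 1) (hnq : n * q ≤ p)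
    (hmean : ∀ e, ∫ ω, x e ω ∂P = 0) (hmom : ∀ e k, 2 ≤ k → |∫ ω, x e ω ^ k ∂P| ≤ q) :
    ∫ ω, (symMatrix (fun e => x e ω) ^ (2 * p)).trace ∂P ≤
      n * (Finset.univ.filter fun w : Fin (2 * p + 1) → Fin (2 * p + 1) =>
        IsDoubledWalk w).card := by
  rw [hx.integral_trace]
  refine le_trans (Finset.sum_le_sum fun w _ => ?_) (sum_doubled_walks_le n p hq0 hnq)
  by_cases hcl : w 0 = w (Fin.last _)
  · rw [if_pos hcl]
    by_cases hw : IsDoubledWalk w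
    · rw [if_pos hw]
      have h1 : ∀ e, |∫ ω, x e ω ^ walkMult w e ∂P| ≤
          if e ∈ Finset.univ.image (walkEdge w) then q else 1 := by
        intro e
        rcases walkMult_of_isDoubledWalk hw e with ⟨h0, he⟩ | ⟨h2, he⟩
        · rw [if_neg he, h0]; simp
        · rw [if_pos he]; exact hmom e _ h2
      calc ∏ e, ∫ ω, x e ω ^ walkMult w e ∂P ≤ |∏ e, ∫ ω, x e ω ^ walkMult w e ∂P| := le_abs_self _
        _ = ∏ e, |∫ ω, x e ω ^ walkMult w e ∂P| := Finset.abs_prod _ _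
        _ ≤ ∏ e, if e ∈ Finset.univ.image (walkEdge w) then q else 1 :=
            Finset.prod_le_prod (fun _ _ => abs_nonneg _) fun e _ => h1 e
        _ = q ^ (Finset.univ.image (walkEdge w)).card := by
            rw [Finset.prod_ite, Finset.prod_const_one, mul_one, Finset.prod_const]
            congr 2
            ext e; simp
        _ ≤ _ := pow_le_pow_of_le_one hq0 hq1 (by
            have := card_vertices_le_card_edges w
            omega)
    · rw [if_neg hw]
      obtain ⟨e, he⟩ := exists_walkMult_eq_one hw hcl
      refine le_of_eq (Finset.prod_eq_zero (Finset.mem_univ e) ?_)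
      rw [he]; simpa using hmean e
  · rw [if_neg hcl]
    split_ifs
    · positivity
    · exact le_rfl

open Classical in
-- The reverse estimate: if all higher moments are at least `1`, every doubled walk contributes at
-- least `1`, and the other walks contribute nothing. This replaces the combinatorial count of
-- doubled walks.
lemma MomentsFactor.card_le_integral_trace {n m : ℕ} {x : Sym2 (Fin n) → Ω → ℝ}
    (hx : MomentsFactor P x) (hmean : ∀ e, ∫ ω, x e ω ∂P = 0)
    (hmom : ∀ e k, 2 ≤ k → 1 ≤ ∫ ω, x e ω ^ k ∂P) :
    ((Finset.univ.filter fun w : Fin (m + 1) → Fin n => IsDoubledWalk w).card : ℝ) ≤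
      ∫ ω, (symMatrix (fun e => x e ω) ^ m).trace ∂P := by
  rw [hx.integral_trace, Finset.card_filter, Nat.cast_sum]
  refine Finset.sum_le_sum fun w _ => ?_
  by_cases hw : IsDoubledWalk w
  · rw [if_pos hw, if_pos hw.1, Nat.cast_one]
    refine Finset.one_le_prod fun e _ => ?_
    rcases walkMult_of_isDoubledWalk hw e with ⟨h0, -⟩ | ⟨h2, -⟩
    · rw [h0]; simp
    · exact hmom e _ h2
  · rw [if_neg hw, Nat.cast_zero]
    split_ifs with hcl
    · obtain ⟨e, he⟩ := exists_walkMult_eq_one hw hcl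
      refine le_of_eq (Finset.prod_eq_zero (Finset.mem_univ e) ?_).symm
      rw [he]; simpa using hmean e
    · exact le_rfl

/-- Bounded independent random variables. -/
lemma momentsFactor_of_iIndepFun {κ : Type*} [Fintype κ] {x : κ → Ω → ℝ} (hx : iIndepFun x P)
    (hm : ∀ e, Measurable (x e)) {B : ℝ} (hB : ∀ e ω, |x e ω| ≤ B) : MomentsFactor P x where
  integrable k := by
    refine Integrable.of_bound (C := ∏ e, B ^ k e) ?_ (Eventually.of_forall fun ω => ?_)
    · exact (Finset.measurable_fun_prod _ fun e _ => (hm e).pow_const _).aestronglyMeasurable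
    · rw [norm_prod]
      refine Finset.prod_le_prod (fun _ _ => norm_nonneg _) fun e _ => ?_
      rw [norm_pow]
      exact pow_le_pow_left₀ (norm_nonneg _) (hB e ω) _
  integral k := by
    have h := hx.comp (fun e (y : ℝ) => y ^ k e) fun e => measurable_id.pow_const _
    exact h.integral_fun_prod_eq_prod_integral fun e =>
      ((hm e).pow_const _).aestronglyMeasurable

end Expectation


/-! ### Operator norms through nets -/

/-- A net of the ball of radius `2` of size at most `5 ^ n`. -/
lemma exists_net (E : Type*) [NormedAddCommGroup E] [NormedSpace ℝ E] [FiniteDimensional ℝ E] :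
    ∃ N : Finset E, N.card ≤ 5 ^ Module.finrank ℝ E ∧ (∀ c ∈ N, ‖c‖ ≤ 2) ∧
      ∀ x : E, ‖x‖ ≤ 2 → ∃ c ∈ N, ‖x - c‖ < 1 := by
  classical
  -- A `1`-separated subset of the ball of maximal size is a net, as a point far from all its
  -- elements could be added. The bound for separated sets ensures that a maximum exists.
  let Sep : Finset E → Prop := fun s =>
    (∀ c ∈ s, ‖c‖ ≤ 2) ∧ ∀ c ∈ s, ∀ d ∈ s, c ≠ d → 1 ≤ ‖c - d‖
  let Q : ℕ → Prop := fun m => ∃ s : Finset E, Sep s ∧ s.card = m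
  have hbound : ∀ m, Q m → m ≤ 5 ^ Module.finrank ℝ E := by
    rintro m ⟨s, hs, rfl⟩
    exact Besicovitch.card_le_of_separated s hs.1 hs.2
  have hQ0 : Q 0 := ⟨∅, ⟨by simp, by simp⟩, rfl⟩
  obtain ⟨N, hN, hcard⟩ := Nat.findGreatest_spec (P := Q) (Nat.zero_le _) hQ0
  refine ⟨N, hbound _ ⟨N, hN, rfl⟩, hN.1, fun x hx => ?_⟩
  by_contra! hfar
  have hxN : x ∉ N := fun h => by
    have := hfar x h
    rw [sub_self, norm_zero] at this
    linarith
  have hins : Q (N.card + 1) := by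
    refine ⟨insert x N, ⟨?_, ?_⟩, Finset.card_insert_of_notMem hxN⟩
    · intro c hc
      rcases Finset.mem_insert.1 hc with rfl | hc
      exacts [hx, hN.1 c hc]
    · intro c hc d hd hcd
      rcases Finset.mem_insert.1 hc with hc' | hc' <;> rcases Finset.mem_insert.1 hd with hd' | hd'
      · exact absurd (hc'.trans hd'.symm) hcd
      · rw [hc']; exact hfar d hd'
      · rw [hd', norm_sub_rev]; exact hfar c hc'
      · exact hN.2 c hc' d hd' hcd
  exact Nat.not_succ_le_self _ ((Nat.le_findGreatest (hbound _ hins) hins).trans hcard.ge)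

/-- A net at scale `1` in the ball of radius `2` approximates unit vectors within `1 / 2`. Used on
the left factor it gives `2 ‖A d‖ ≤ B + ‖A d‖`, then on the right factor `2 ‖A‖ ≤ B + ‖A‖`. -/
lemma norm_map_le_of_net {E : Type*} [NormedAddCommGroup E] [InnerProductSpace ℝ E]
    [FiniteDimensional ℝ E] {N : Finset E}
    (hN : ∀ x : E, ‖x‖ ≤ 2 → ∃ c ∈ N, ‖x - c‖ < 1) (A : E →ₗ[ℝ] E) {B : ℝ} (hB : 0 ≤ B)
    (h : ∀ c ∈ N, ∀ d ∈ N, |inner ℝ c (A d)| ≤ B) (w : E) : ‖A w‖ ≤ B * ‖w‖ := by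
  have h1 : ∀ d ∈ N, ‖A d‖ ≤ B := by
    intro d hd
    rcases eq_or_ne (A d) 0 with h0 | h0
    · rw [h0, norm_zero]; exact hB
    have hpos : 0 < ‖A d‖ := norm_pos_iff.2 h0
    obtain ⟨c, hc, hxc⟩ := hN ((2 / ‖A d‖) • A d) (by
      rw [norm_smul, norm_div, norm_norm, Real.norm_eq_abs, abs_two,
        div_mul_cancel₀ _ hpos.ne'])
    have h2 : inner ℝ ((2 / ‖A d‖) • A d) (A d) = 2 * ‖A d‖ := by
      rw [inner_smul_left, real_inner_self_eq_norm_sq]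
      simp only [conj_trivial]
      field_simp
    have h3 : inner ℝ ((2 / ‖A d‖) • A d) (A d) =
        inner ℝ c (A d) + inner ℝ ((2 / ‖A d‖) • A d - c) (A d) := by
      rw [inner_sub_left]; ring
    have h4 := real_inner_le_norm ((2 / ‖A d‖) • A d - c) (A d)
    have h5 := (abs_le.1 (h c hc d hd)).2
    nlinarith
  let T : E →L[ℝ] E := LinearMap.toContinuousLinearMap A
  have hTA : ∀ x, T x = A x := fun _ => rfl
  have h6 : ‖T‖ ≤ (B + ‖T‖) / 2 := by
    refine T.opNorm_le_bound (by positivity) fun x => ?_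
    rcases eq_or_ne x 0 with rfl | h0
    · simp
    have hpos : 0 < ‖x‖ := norm_pos_iff.2 h0
    obtain ⟨c, hc, hxc⟩ := hN ((2 / ‖x‖) • x) (by
      rw [norm_smul, norm_div, norm_norm, Real.norm_eq_abs, abs_two,
        div_mul_cancel₀ _ hpos.ne'])
    have h7 : T ((2 / ‖x‖) • x) = T c + T ((2 / ‖x‖) • x - c) := by rw [map_sub]; abel
    have h8 : ‖T ((2 / ‖x‖) • x)‖ ≤ B + ‖T‖ := by
      rw [h7]
      refine (norm_add_le _ _).trans (add_le_add (h1 c hc) ?_)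
      exact (T.le_opNorm _).trans (mul_le_of_le_one_right (norm_nonneg _) hxc.le)
    rw [map_smul, norm_smul, norm_div, norm_norm, Real.norm_eq_abs, abs_two, div_mul_eq_mul_div,
      div_le_iff₀ hpos] at h8
    linarith
  have h9 : ‖T‖ ≤ B := by linarith
  exact (T.le_opNorm w).trans (by gcongr)

/-! ### A skewed two-point law as comparison -/

/-- The centred law with values `2` and `-1`, all of whose higher moments are at least `1`. -/
def skewLaw : Measure Bool :=
  ENNReal.ofReal (1 / 3) • Measure.dirac true + ENNReal.ofReal (2 / 3) • Measure.dirac false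

/-- The values of the two-point law. -/
def skewValue (b : Bool) : ℝ := if b then 2 else -1

instance : IsProbabilityMeasure skewLaw := ⟨by
  simp only [skewLaw, Measure.coe_add, Measure.coe_smul, Pi.add_apply, Pi.smul_apply,
    measure_univ, smul_eq_mul, mul_one]
  rw [← ENNReal.ofReal_add (by norm_num) (by norm_num)]
  norm_num⟩

lemma integral_skewLaw (f : Bool → ℝ) :
    ∫ b, f b ∂skewLaw = 1 / 3 * f true + 2 / 3 * f false := by
  have h (a : ℝ) (b : Bool) : IsFiniteMeasure (ENNReal.ofReal a • Measure.dirac b) :=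
    Measure.smul_finite _ ENNReal.ofReal_ne_top
  have h1 := h (1 / 3) true
  have h2 := h (2 / 3) false
  rw [skewLaw, integral_add_measure .of_finite .of_finite, integral_smul_measure,
    integral_smul_measure, integral_dirac, integral_dirac,
    ENNReal.toReal_ofReal (by norm_num), ENNReal.toReal_ofReal (by norm_num)]
  rfl

/-- The moment is `(2 ^ k + 2 (-1) ^ k) / 3`. Skewness is essential here: the odd moments of a
symmetric law vanish. -/
lemma one_le_integral_skewValue_pow {k : ℕ} (hk : 2 ≤ k) :
    1 ≤ ∫ b, skewValue b ^ k ∂skewLaw := by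
  rw [integral_skewLaw]
  simp only [skewValue, if_true, Bool.false_eq_true, if_false]
  obtain ⟨j, rfl⟩ := Nat.exists_eq_add_of_le hk
  rcases Nat.eq_zero_or_pos j with rfl | hj
  · norm_num
  · have h1 : (-1 : ℝ) ≤ (-1) ^ (2 + j) := by
      rcases neg_one_pow_eq_or ℝ (2 + j) with h | h <;> norm_num [h]
    have h2 : (2 : ℝ) ^ 3 ≤ 2 ^ (2 + j) := pow_le_pow_right₀ (by norm_num) (by omega)
    linarith

/-- Hoeffding's lemma for an interval of length `3`: the variance proxy is `(3 / 2) ^ 2`, and half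
of it is `9 / 8`. -/
lemma integral_exp_skewValue_le (b : ℝ) :
    ∫ y, Real.exp (b * skewValue y) ∂skewLaw ≤ Real.exp (9 / 8 * b ^ 2) := by
  have h := hasSubgaussianMGF_of_mem_Icc_of_integral_eq_zero (μ := skewLaw) (X := skewValue)
    (a := -1) (b := 2) (measurable_of_countable _).aemeasurable
    (Eventually.of_forall fun y => by cases y <;> constructor <;> norm_num [skewValue])
    (by rw [integral_skewLaw]; norm_num [skewValue])
  refine (h.mgf_le b).trans (le_of_eq ?_)
  congr 1
  simp only [NNReal.coe_pow, NNReal.coe_div, coe_nnnorm, NNReal.coe_ofNat]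
  norm_num
  ring

/-- The independent family on the edges with the two-point law. -/
def skewFamily (r : ℕ) (e : Sym2 (Fin r)) (ω : Sym2 (Fin r) → Bool) : ℝ := skewValue (ω e)

/-- The law of the independent family. -/
abbrev skewMeasure (r : ℕ) : Measure (Sym2 (Fin r) → Bool) := Measure.pi fun _ => skewLaw

lemma iIndepFun_skewFamily (r : ℕ) : iIndepFun (skewFamily r) (skewMeasure r) :=
  iIndepFun_pi (X := fun _ => skewValue) fun _ => (measurable_of_countable _).aemeasurable

lemma integral_comp_skewFamily {r : ℕ} (e : Sym2 (Fin r)) (f : ℝ → ℝ) :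
    ∫ ω, f (skewFamily r e ω) ∂skewMeasure r = ∫ b, f (skewValue b) ∂skewLaw :=
  integral_comp_eval (μ := fun _ : Sym2 (Fin r) => skewLaw) (i := e)
    (f := fun b => f (skewValue b)) (measurable_of_countable _).aestronglyMeasurable

lemma abs_skewFamily_le {r : ℕ} (e : Sym2 (Fin r)) (ω : Sym2 (Fin r) → Bool) :
    |skewFamily r e ω| ≤ 2 := by
  unfold skewFamily skewValue
  split_ifs <;> norm_num

lemma momentsFactor_skewFamily (r : ℕ) : MomentsFactor (skewMeasure r) (skewFamily r) :=
  momentsFactor_of_iIndepFun (iIndepFun_skewFamily r) (fun _ => measurable_of_countable _)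
    abs_skewFamily_le

lemma integral_exp_sum_skewFamily_le {r : ℕ} (b : Sym2 (Fin r) → ℝ) :
    ∫ ω, Real.exp (∑ e, b e * skewFamily r e ω) ∂skewMeasure r ≤
      Real.exp (9 / 8 * ∑ e, b e ^ 2) := by
  simp only [Real.exp_sum]
  have h := (iIndepFun_skewFamily r).comp (fun e (y : ℝ) => Real.exp (b e * y))
    fun e => by fun_prop
  have h1 := h.integral_fun_prod_eq_prod_integral fun e =>
    (measurable_of_countable _).aestronglyMeasurable
  simp only [Function.comp_apply] at h1
  rw [h1, Finset.mul_sum, Real.exp_sum]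
  refine Finset.prod_le_prod (fun e _ => integral_nonneg fun _ => (Real.exp_pos _).le) fun e _ => ?_
  rw [integral_comp_skewFamily e fun y => Real.exp (b e * y)]
  exact integral_exp_skewValue_le _

/-- Subgaussian moments, from `y ^ (2 p) ≤ (2 p)! exp |y|` at `√p` times the sum. The `32` is what
net points of norm at most `2` produce, `36 = 9 / 8 * 32`, and `(2 p)! / p ^ p ≤ (4 p) ^ p`. -/
lemma integral_sum_skewFamily_pow_le {r p : ℕ} (hp : 0 < p) {b : Sym2 (Fin r) → ℝ}
    (hb : ∑ e, b e ^ 2 ≤ 32) :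
    ∫ ω, (∑ e, b e * skewFamily r e ω) ^ (2 * p) ∂skewMeasure r ≤
      2 * (4 * Real.exp 36 * p) ^ p := by
  have hp' : (0 : ℝ) < p := by exact_mod_cast hp
  have hpt : ∀ ω, (∑ e, b e * skewFamily r e ω) ^ (2 * p) ≤ (2 * p).factorial / (p : ℝ) ^ p *
      (Real.exp (∑ e, (√p * b e) * skewFamily r e ω) +
        Real.exp (∑ e, (-√p * b e) * skewFamily r e ω)) := by
    intro ω
    set Q := ∑ e, b e * skewFamily r e ω
    have h1 : ∑ e, (√p * b e) * skewFamily r e ω = √p * Q := by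
      simp only [Q, Finset.mul_sum, mul_assoc]
    have h2 : ∑ e, (-√p * b e) * skewFamily r e ω = -(√p * Q) := by
      simp only [Q, Finset.mul_sum, mul_assoc, neg_mul, Finset.sum_neg_distrib]
    rw [h1, h2]
    have h3 := Real.pow_div_factorial_le_exp _ (abs_nonneg (√p * Q)) (2 * p)
    rw [(even_two_mul p).pow_abs, mul_pow, pow_mul (√(p : ℝ)), Real.sq_sqrt hp'.le,
      div_le_iff₀ (by positivity)] at h3
    have h4 : Real.exp |√p * Q| ≤ Real.exp (√p * Q) + Real.exp (-(√p * Q)) := by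
      rcases abs_choice (√p * Q) with h | h <;> rw [h]
      · linarith [Real.exp_pos (-(√p * Q))]
      · linarith [Real.exp_pos (√p * Q)]
    rw [div_mul_eq_mul_div, le_div_iff₀ (by positivity)]
    calc Q ^ (2 * p) * (p : ℝ) ^ p = (p : ℝ) ^ p * Q ^ (2 * p) := mul_comm _ _
      _ ≤ _ := h3
      _ ≤ _ := by rw [mul_comm]; gcongr
  have hexp : ∀ σ : ℝ, σ ^ 2 = p →
      ∫ ω, Real.exp (∑ e, (σ * b e) * skewFamily r e ω) ∂skewMeasure r ≤ Real.exp 36 ^ p := by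
    intro σ hσ
    refine (integral_exp_sum_skewFamily_le _).trans ?_
    rw [← Real.exp_nat_mul]
    refine Real.exp_le_exp.2 ?_
    simp only [mul_pow, hσ, ← Finset.mul_sum]
    nlinarith
  have hfac : ((2 * p).factorial : ℝ) ≤ (2 * p) ^ (2 * p) := by
    exact_mod_cast Nat.factorial_le_pow (2 * p)
  calc ∫ ω, (∑ e, b e * skewFamily r e ω) ^ (2 * p) ∂skewMeasure r
      ≤ ∫ ω, (2 * p).factorial / (p : ℝ) ^ p *
      (Real.exp (∑ e, (√p * b e) * skewFamily r e ω) +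
        Real.exp (∑ e, (-√p * b e) * skewFamily r e ω)) ∂skewMeasure r :=
        integral_mono .of_finite .of_finite hpt
    _ = (2 * p).factorial / (p : ℝ) ^ p *
      (∫ ω, Real.exp (∑ e, (√p * b e) * skewFamily r e ω) ∂skewMeasure r +
        ∫ ω, Real.exp (∑ e, (-√p * b e) * skewFamily r e ω) ∂skewMeasure r) := by
        rw [integral_const_mul, integral_add .of_finite .of_finite]
    _ ≤ (2 * p) ^ (2 * p) / (p : ℝ) ^ p * (Real.exp 36 ^ p + Real.exp 36 ^ p) := by
        gcongr
        · exact hexp _ (Real.sq_sqrt hp'.le)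
        · exact hexp _ (by rw [neg_sq, Real.sq_sqrt hp'.le])
    _ = 2 * (4 * Real.exp 36 * p) ^ p := by
        rw [pow_mul (2 * (p : ℝ)), mul_pow 2, mul_pow, mul_pow, mul_pow, ← pow_mul (p : ℝ),
          two_mul p, pow_add]
        field_simp
        norm_num
        ring

lemma inner_symMatrix {r : ℕ} (y : Sym2 (Fin r) → ℝ) (c d : EuclideanSpace ℝ (Fin r)) :
    inner ℝ c (Matrix.toEuclideanLin (symMatrix y) d) =
      ∑ e, (∑ ij ∈ Finset.univ.filter (fun ij : Fin r × Fin r => s(ij.1, ij.2) = e),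
        c ij.1 * d ij.2) * y e := by
  have h1 : inner ℝ c (Matrix.toEuclideanLin (symMatrix y) d) =
      ∑ ij : Fin r × Fin r, c ij.1 * d ij.2 * y s(ij.1, ij.2) := by
    rw [Fintype.sum_prod_type]
    simp only [PiLp.inner_apply, Matrix.toLpLin_apply, Matrix.mulVec, dotProduct, symMatrix,
      Matrix.of_apply, RCLike.inner_apply, conj_trivial, Finset.sum_mul]
    refine Finset.sum_congr rfl fun i _ => Finset.sum_congr rfl fun j _ => ?_
    ring
  rw [h1, ← Finset.sum_fiberwise _ (fun ij : Fin r × Fin r => s(ij.1, ij.2))]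
  refine Finset.sum_congr rfl fun e _ => ?_
  rw [Finset.sum_mul]
  refine Finset.sum_congr rfl fun ij hij => ?_
  rw [(Finset.mem_filter.1 hij).2]

/-- An unordered pair comes from at most two ordered ones, which costs the factor `2` by
Cauchy-Schwarz. -/
lemma sum_sq_coeff_le {r : ℕ} (c d : EuclideanSpace ℝ (Fin r)) :
    ∑ e : Sym2 (Fin r), (∑ ij ∈ Finset.univ.filter
      (fun ij : Fin r × Fin r => s(ij.1, ij.2) = e), c ij.1 * d ij.2) ^ 2 ≤
      2 * (‖c‖ ^ 2 * ‖d‖ ^ 2) := by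
  have hcard : ∀ e : Sym2 (Fin r),
      (Finset.univ.filter fun ij : Fin r × Fin r => s(ij.1, ij.2) = e).card ≤ 2 := by
    intro e
    induction e using Sym2.ind with
    | _ a b =>
      refine (Finset.card_le_card (t := ({(a, b), (b, a)} : Finset (Fin r × Fin r)))
        fun ij hij => ?_).trans Finset.card_le_two
      have h := (Finset.mem_filter.1 hij).2
      rw [Sym2.eq_iff] at h
      simp only [Finset.mem_insert, Finset.mem_singleton, Prod.ext_iff]
      exact h
  calc _ ≤ ∑ e : Sym2 (Fin r), 2 *
          ∑ ij ∈ Finset.univ.filter (fun ij : Fin r × Fin r => s(ij.1, ij.2) = e),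
            (c ij.1 * d ij.2) ^ 2 := by
        refine Finset.sum_le_sum fun e _ => sq_sum_le_card_mul_sum_sq.trans ?_
        gcongr
        exact_mod_cast hcard e
    _ = 2 * ∑ ij : Fin r × Fin r, (c ij.1 * d ij.2) ^ 2 := by
        rw [← Finset.mul_sum, Finset.sum_fiberwise]
    _ = _ := by
        rw [Fintype.sum_prod_type, EuclideanSpace.norm_sq_eq, EuclideanSpace.norm_sq_eq,
          Finset.sum_mul_sum]
        simp [mul_pow]

/-- Expected trace of the comparison matrix. -/
lemma integral_trace_skewFamily_le {p : ℕ} (hp : 0 < p) :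
    ∫ ω, (symMatrix (fun e => skewFamily (2 * p + 1) e ω) ^ (2 * p)).trace
      ∂skewMeasure (2 * p + 1) ≤ (375000 * Real.exp 36 * p) ^ p := by
  obtain ⟨r, hr⟩ : ∃ r, r = 2 * p + 1 := ⟨_, rfl⟩
  rw [← hr]
  obtain ⟨N, hNcard, hN2, hN⟩ := exists_net (EuclideanSpace ℝ (Fin r))
  rw [finrank_euclideanSpace_fin] at hNcard
  let Q : EuclideanSpace ℝ (Fin r) × EuclideanSpace ℝ (Fin r) → (Sym2 (Fin r) → Bool) → ℝ :=
    fun cd ω => inner ℝ cd.1 (Matrix.toEuclideanLin (symMatrix fun e => skewFamily r e ω) cd.2)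
  have hne : (N ×ˢ N).Nonempty := by
    obtain ⟨c, hc, -⟩ := hN 0 (by simp)
    exact ⟨(c, c), Finset.mk_mem_product hc hc⟩
  -- The trace is at most `r` times the `2 p`-th power of the norm, and the maximum over pairs of
  -- net points is replaced by a sum.
  have hpt : ∀ ω, (symMatrix (fun e => skewFamily r e ω) ^ (2 * p)).trace ≤
      r * ∑ cd ∈ N ×ˢ N, Q cd ω ^ (2 * p) := by
    intro ω
    obtain ⟨cd, hcd, hmax⟩ := Finset.exists_max_image (N ×ˢ N) (fun cd => |Q cd ω|) hne
    have h1 := norm_map_le_of_net hN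
      (Matrix.toEuclideanLin (symMatrix fun e => skewFamily r e ω)) (abs_nonneg (Q cd ω))
      fun c hc d hd => hmax (c, d) (Finset.mk_mem_product hc hd)
    refine (trace_pow_le_of_norm_le (symMatrix_isHermitian _) p h1).trans ?_
    rw [(even_two_mul p).pow_abs]
    gcongr
    exact Finset.single_le_sum (f := fun cd => Q cd ω ^ (2 * p))
      (fun _ _ => (even_two_mul p).pow_nonneg _) hcd
  have hQ : ∀ cd ∈ N ×ˢ N, ∫ ω, Q cd ω ^ (2 * p) ∂skewMeasure r ≤
      2 * (4 * Real.exp 36 * p) ^ p := by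
    intro cd hcd
    simp only [Q, inner_symMatrix]
    refine integral_sum_skewFamily_pow_le hp ((sum_sq_coeff_le _ _).trans ?_)
    have h1 := hN2 _ (Finset.mem_product.1 hcd).1
    have h2 := hN2 _ (Finset.mem_product.1 hcd).2
    have h3 : ‖cd.1‖ ^ 2 ≤ 2 ^ 2 := by gcongr
    have h4 : ‖cd.2‖ ^ 2 ≤ 2 ^ 2 := by gcongr
    nlinarith [sq_nonneg ‖cd.1‖, sq_nonneg ‖cd.2‖]
  have hcard : ((N ×ˢ N).card : ℝ) ≤ 25 * 625 ^ p := by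
    rw [Finset.card_product]
    have h1 : (N.card : ℝ) ≤ 5 ^ r := by exact_mod_cast hNcard
    calc ((N.card * N.card : ℕ) : ℝ) = N.card * N.card := by push_cast; ring
      _ ≤ 5 ^ r * 5 ^ r := by gcongr
      _ = 25 * 625 ^ p := by
        rw [← mul_pow, hr, pow_succ, pow_mul]; norm_num; ring
  have hr3 : (r : ℝ) ≤ 3 ^ p := by
    have := one_add_mul_le_pow (a := (2 : ℝ)) (by norm_num) p
    rw [hr]; push_cast
    norm_num at this ⊢
    linarith
  calc _ ≤ ∫ ω, r * ∑ cd ∈ N ×ˢ N, Q cd ω ^ (2 * p) ∂skewMeasure r :=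
        integral_mono .of_finite .of_finite hpt
    _ = r * ∑ cd ∈ N ×ˢ N, ∫ ω, Q cd ω ^ (2 * p) ∂skewMeasure r := by
        rw [integral_const_mul, integral_finsetSum _ fun _ _ => .of_finite]
    _ ≤ r * ((N ×ˢ N).card • (2 * (4 * Real.exp 36 * p) ^ p)) := by
        gcongr
        exact Finset.sum_le_card_nsmul _ _ _ hQ
    _ ≤ 3 ^ p * ((25 * 625 ^ p) * (2 * (4 * Real.exp 36 * p) ^ p)) := by
        rw [nsmul_eq_mul]; gcongr
    _ = 50 * (7500 * Real.exp 36 * p) ^ p := by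
        have : 7500 * Real.exp 36 * p = 3 * 625 * (4 * Real.exp 36 * p) := by ring
        rw [this, mul_pow (3 * 625 : ℝ), mul_pow (3 : ℝ)]; ring
    -- All prefactors go into the base of the power: `3` from the dimension, `625` from the pairs in
    -- the net, `4` from the moments, and `50` from the remaining factors `25` and `2`.
    _ ≤ 50 ^ p * (7500 * Real.exp 36 * p) ^ p := by
        gcongr
        exact le_self_pow₀ (by norm_num) hp.ne'
    _ = _ := by rw [← mul_pow]; ring_nf


/-! ### Concentration of random symmetric matrices -/

/-- The constant in the concentration inequality. -/
def normConst : ℝ := Real.exp 1 * (375000 * Real.exp 36)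

lemma normConst_pos : 0 < normConst := by unfold normConst; positivity

section Concentration

variable {Ω : Type*} [MeasurableSpace Ω] {P : Measure Ω} [IsProbabilityMeasure P]

lemma one_sub_le_measureReal_of_compl_le {S : Set Ω} {a : ℝ} (h : P.real Sᶜ ≤ a) :
    1 - a ≤ P.real S := by
  have h1 := measureReal_union_le (μ := P) S Sᶜ
  rw [Set.union_compl_self, probReal_univ] at h1
  linarith

/-- A symmetric random matrix with centred entries, independent up to symmetry, bounded by `1` and
with variance at most `p / n`, has norm `O (√p)` up to probability `n exp (-p)`. -/
lemma measureReal_norm_symMatrix_le {n p : ℕ} (hp : 0 < p) {x : Sym2 (Fin n) → Ω → ℝ}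
    (hx : MomentsFactor P x) {q : ℝ} (hq0 : 0 ≤ q) (hq1 : q ≤ 1) (hnq : n * q ≤ p)
    (hmean : ∀ e, ∫ ω, x e ω ∂P = 0) (hmom : ∀ e k, 2 ≤ k → |∫ ω, x e ω ^ k ∂P| ≤ q) :
    1 - n * Real.exp (-p) ≤ P.real {ω | ∀ w,
      ‖Matrix.toEuclideanLin (symMatrix fun e => x e ω) w‖ ≤ √(normConst * p) * ‖w‖} := by
  have hp' : (0 : ℝ) < p := by exact_mod_cast hp
  have hC := normConst_pos
  refine one_sub_le_measureReal_of_compl_le ?_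
  set S := {ω | (normConst * p) ^ p ≤ (symMatrix (fun e => x e ω) ^ (2 * p)).trace} with hS
  have hsub : {ω | ∀ w,
      ‖Matrix.toEuclideanLin (symMatrix fun e => x e ω) w‖ ≤ √(normConst * p) * ‖w‖}ᶜ ⊆ S := by
    intro ω hω
    by_contra hωS
    refine hω fun w => ?_
    exact norm_toEuclideanLin_le_of_trace_pow_le (symMatrix_isHermitian _) hp.ne' (by positivity)
      (not_le.1 hωS).le w
  refine (measureReal_mono hsub).trans ?_
  have hnonneg : ∀ ω, 0 ≤ (symMatrix (fun e => x e ω) ^ (2 * p)).trace := fun ω => by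
    rw [trace_pow_eq_sum_eigenvalues
      (Matrix.isSymmetric_toEuclideanLin_iff.2 (symMatrix_isHermitian _))]
    exact Finset.sum_nonneg fun _ _ => (even_two_mul p).pow_nonneg _
  have hmarkov := mul_meas_ge_le_integral_of_nonneg (μ := P) (Eventually.of_forall hnonneg)
    (hx.integrable_trace (2 * p)) ((normConst * p) ^ p)
  have htrace := hx.integral_trace_le hq0 hq1 hnq hmean hmom
  have hcomp := (momentsFactor_skewFamily (2 * p + 1)).card_le_integral_trace (m := 2 * p)
    (fun e => by
      rw [integral_comp_skewFamily e fun y => y, integral_skewLaw]; norm_num [skewValue])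
    fun e k hk => by
      rw [integral_comp_skewFamily e fun y => y ^ k]; exact one_le_integral_skewValue_pow hk
  have hbound := hmarkov.trans (htrace.trans (mul_le_mul_of_nonneg_left
    (hcomp.trans (integral_trace_skewFamily_le hp)) (Nat.cast_nonneg n)))
  -- The factor `exp 1` in `normConst` is the margin of the threshold over the expected trace; to
  -- the power `p` it yields the probability `exp (-p)` in Markov's inequality.
  have hfactor : (normConst * p) ^ p = Real.exp p * (375000 * Real.exp 36 * p) ^ p := by
    rw [normConst, mul_assoc, mul_pow (Real.exp 1), ← Real.exp_nat_mul, mul_one]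
  rw [hfactor] at hbound
  have hpos : 0 < (375000 * Real.exp 36 * (p : ℝ)) ^ p := by positivity
  have h1 : Real.exp p * P.real S ≤ n := by
    refine le_of_mul_le_mul_right ?_ hpos
    rw [hS, hfactor]
    refine le_trans (le_of_eq ?_) hbound
    simp only [Measure.real]
    ring
  rw [Real.exp_neg, ← div_eq_mul_inv, le_div_iff₀ (Real.exp_pos _), mul_comm]
  exact h1

end Concentration

/-! ### Extension of independent families by zero -/

lemma prod_eq_prod_compl_range_mul {κ κ' : Type*} [Fintype κ] [Fintype κ'] {f : κ' → κ}
    (hf : Function.Injective f) [DecidablePred (· ∈ Set.range f)] (F : κ → ℝ) :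
    ∏ e, F e = (∏ e ∈ Finset.univ.filter (fun e => ¬ e ∈ Set.range f), F e) * ∏ e', F (f e') := by
  classical
  rw [← Finset.prod_filter_mul_prod_filter_not Finset.univ (fun e => e ∈ Set.range f), mul_comm]
  congr 1
  rw [← Finset.prod_image (f := F) (g := f) fun a _ b _ h => hf h]
  refine Finset.prod_congr ?_ fun _ _ => rfl
  ext e
  simp

/-- Serves to include the diagonal, where the noise is zero. With `0 ^ 0 = 1`, the edges that a
monomial does not involve leave it unchanged. -/
lemma MomentsFactor.extend {Ω : Type*} [MeasurableSpace Ω] {P : Measure Ω} [IsProbabilityMeasure P]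
    {κ κ' : Type*} [Fintype κ] [Fintype κ'] {f : κ' → κ} (hf : Function.Injective f)
    {y : κ' → Ω → ℝ} (hy : MomentsFactor P y) : MomentsFactor P (Function.extend f y 0) := by
  classical
  have h0 : ∀ e ∈ Finset.univ.filter (fun e => ¬ e ∈ Set.range f),
      Function.extend f y 0 e = 0 := fun e he =>
    Function.extend_apply' _ _ _ (Finset.mem_filter.1 he).2
  have hprod : ∀ (k : κ → ℕ) ω, ∏ e, Function.extend f y 0 e ω ^ k e =
      (∏ e ∈ Finset.univ.filter (fun e => ¬ e ∈ Set.range f), (0 : ℝ) ^ k e) *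
        ∏ e', y e' ω ^ k (f e') := fun k ω => by
    rw [prod_eq_prod_compl_range_mul hf]
    congr 1
    · exact Finset.prod_congr rfl fun e he => by rw [h0 e he]; rfl
    · simp only [hf.extend_apply]
  refine ⟨fun k => ?_, fun k => ?_⟩
  · simp only [hprod]
    exact (hy.integrable _).const_mul _
  · simp only [hprod]
    rw [integral_const_mul, hy.integral, prod_eq_prod_compl_range_mul hf]
    congr 1
    · exact Finset.prod_congr rfl fun e he => by rw [h0 e he]; simp
    · simp only [hf.extend_apply]

/-! ### The adjacency matrix of the CHIP model -/

/-- Without history the conditioning is trivial and the intensity is the constant `μ`, so the first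
event time is exponential and `α`, `β` drop out. -/
lemma IsHawkes.measureReal_lt {Ω : Type*} [MeasurableSpace Ω] {P : Measure Ω}
    [IsProbabilityMeasure P] {μ α β : ℝ} {t : ℕ → Ω → ℝ} (h : IsHawkes P μ α β t) {T : ℝ}
    (hT : 0 < T) : P.real {ω | T < t 0 ω} = Real.exp (-(μ * T)) := by
  have h1 := h.survival 0 T
  have h2 : pastSigma t 0 = ⊥ := iSup_of_empty _
  rw [h2, condExp_bot] at h1
  have hms : MeasurableSet {ω | T < t 0 ω} := measurableSet_lt measurable_const (h.measurable 0)
  rw [integral_indicator hms, setIntegral_const, smul_eq_mul, mul_one] at h1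
  obtain ⟨ω, hω⟩ := h1.exists
  refine hω.trans ?_
  simp only [prevTime, hawkesIntensity, max_eq_left hT.le, Finset.range_zero, Finset.filter_empty,
    Finset.sum_empty, add_zero, intervalIntegral.integral_const, sub_zero, smul_eq_mul]
  rw [mul_comm]

open Classical in
/-- Indicator of an event up to time `T`. -/
def hasEvent (T : ℝ) (s : ℕ → ℝ) : ℝ := if ∃ l, s l ≤ T then 1 else 0

lemma measurableSet_hasEvent (T : ℝ) : MeasurableSet {s : ℕ → ℝ | ∃ l, s l ≤ T} := by
  have : {s : ℕ → ℝ | ∃ l, s l ≤ T} = ⋃ l, {s | s l ≤ T} := by ext; simp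
  rw [this]
  exact MeasurableSet.iUnion fun l => measurableSet_le (measurable_pi_apply l) measurable_const

lemma measurable_hasEvent (T : ℝ) : Measurable (hasEvent T) :=
  Measurable.ite (measurableSet_hasEvent T) measurable_const measurable_const

lemma hasEvent_eq_zero_or_one (T : ℝ) (s : ℕ → ℝ) : hasEvent T s = 0 ∨ hasEvent T s = 1 := by
  unfold hasEvent; split_ifs <;> simp

lemma IsHawkes.measurable_hasEvent {Ω : Type*} [MeasurableSpace Ω] {P : Measure Ω}
    {μ α β : ℝ} {t : ℕ → Ω → ℝ} (h : IsHawkes P μ α β t) (T : ℝ) :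
    Measurable fun ω => hasEvent T fun l => t l ω :=
  (CHIP.measurable_hasEvent T).comp (measurable_pi_iff.2 h.measurable)

lemma IsHawkes.integral_hasEvent {Ω : Type*} [MeasurableSpace Ω] {P : Measure Ω}
    [IsProbabilityMeasure P] {μ α β : ℝ} {t : ℕ → Ω → ℝ} (h : IsHawkes P μ α β t) {T : ℝ}
    (hT : 0 < T) : ∫ ω, hasEvent T (fun l => t l ω) ∂P = 1 - Real.exp (-(μ * T)) := by
  have hms : MeasurableSet {ω | T < t 0 ω} := measurableSet_lt measurable_const (h.measurable 0)
  have h1 : (fun ω => hasEvent T fun l => t l ω) =ᵐ[P]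
      fun ω => 1 - Set.indicator {ω | T < t 0 ω} (fun _ => (1 : ℝ)) ω := by
    filter_upwards [h.increasing] with ω hω
    have hmono : ∀ l, t 0 ω ≤ t l ω := fun l => by
      induction l with
      | zero => exact le_rfl
      | succ l ih => exact ih.trans (hω (l + 1)).le
    by_cases hlt : T < t 0 ω
    · rw [Set.indicator_of_mem (by exact hlt), hasEvent, if_neg, sub_self]
      rintro ⟨l, hl⟩
      exact absurd (hmono l) (not_le.2 (hl.trans_lt hlt))
    · rw [Set.indicator_of_notMem (by exact hlt), hasEvent, if_pos ⟨0, not_lt.1 hlt⟩, sub_zero]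
  rw [integral_congr_ae h1, integral_sub (integrable_const _)
    ((integrable_const _).indicator hms), integral_indicator hms, setIntegral_const,
    h.measureReal_lt hT]
  simp

/-- Centred moments of a Bernoulli variable. -/
lemma abs_integral_centered_pow_le {Ω : Type*} [MeasurableSpace Ω] {P : Measure Ω}
    [IsProbabilityMeasure P] {a : Ω → ℝ} (hm : Measurable a) (ha : ∀ ω, a ω = 0 ∨ a ω = 1) {π : ℝ}
    (hπ : ∫ ω, a ω ∂P = π) (hπ0 : 0 ≤ π) (hπ1 : π ≤ 1) {k : ℕ} (hk : 2 ≤ k) :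
    |∫ ω, (a ω - π) ^ k ∂P| ≤ π := by
  have hint : Integrable a P := Integrable.of_bound hm.aestronglyMeasurable (C := 1)
    (Eventually.of_forall fun ω => by rcases ha ω with h | h <;> simp [h])
  have habs : ∀ ω, |a ω - π| ≤ 1 := fun ω => by
    rw [abs_le]
    rcases ha ω with h | h <;> rw [h] <;> constructor <;> linarith
  have hsq : ∀ ω, (a ω - π) ^ 2 = (1 - 2 * π) * a ω + π ^ 2 := fun ω => by
    rcases ha ω with h | h <;> rw [h] <;> ring
  calc |∫ ω, (a ω - π) ^ k ∂P| ≤ ∫ ω, |(a ω - π) ^ k| ∂P := abs_integral_le_integral_abs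
    _ ≤ ∫ ω, ((1 - 2 * π) * a ω + π ^ 2) ∂P := by
        refine integral_mono_of_nonneg (Eventually.of_forall fun _ => abs_nonneg _)
          ((hint.const_mul _).add (integrable_const _)) (Eventually.of_forall fun ω => ?_)
        simp only
        rw [← hsq, abs_pow, ← sq_abs]
        exact pow_le_pow_of_le_one (abs_nonneg _) (habs ω) hk
    _ = π - π ^ 2 := by
        rw [integral_add (hint.const_mul _) (integrable_const _), integral_const_mul, hπ]
        simp; ring
    _ ≤ π := by nlinarith

/-- The pair of nodes as an unordered pair. -/
def pairEdge {n : ℕ} (p : {p : Fin n × Fin n // p.1 < p.2}) : Sym2 (Fin n) := s(p.1.1, p.1.2)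

lemma pairEdge_injective {n : ℕ} : Function.Injective (pairEdge (n := n)) := by
  rintro ⟨⟨a, b⟩, hab⟩ ⟨⟨a', b'⟩, hab'⟩ h
  simp only [pairEdge, Sym2.eq_iff] at h
  rcases h with ⟨rfl, rfl⟩ | ⟨rfl, rfl⟩
  · rfl
  · exact absurd hab (not_lt.2 hab'.le)

/-- The centred adjacency variables of the pairs of nodes. -/
def centeredEdge {Ω : Type u} {n k : ℕ} (c : Fin n → Fin k) (p q : ℝ)
    (t : Fin n → Fin n → ℕ → Ω → ℝ) (T : ℝ) (e : {p : Fin n × Fin n // p.1 < p.2}) (ω : Ω) : ℝ :=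
  hasEvent T (fun l => t e.1.1 e.1.2 l ω) - blockMatrix c p q e.1.1 e.1.2

lemma adjacency_apply_of_ne {Ω : Type u} {n : ℕ} (t : Fin n → Fin n → ℕ → Ω → ℝ) (T : ℝ) (ω : Ω)
    {i j : Fin n} (h : i ≠ j) :
    adjacency t T ω i j = hasEvent T fun l => t (min i j) (max i j) l ω := by
  have hiff : 0 < eventCount t T ω i j ↔ ∃ l, t (min i j) (max i j) l ω ≤ T := Set.encard_pos
  simp only [adjacency, Matrix.of_apply, hasEvent]
  by_cases hex : ∃ l, t (min i j) (max i j) l ω ≤ T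
  · rw [if_pos hex, if_pos ⟨h, hiff.2 hex⟩]
  · rw [if_neg hex, if_neg fun h' => hex (hiff.1 h'.2)]

lemma adjacency_isHermitian {Ω : Type u} {n : ℕ} (t : Fin n → Fin n → ℕ → Ω → ℝ) (T : ℝ) (ω : Ω) :
    (adjacency t T ω).IsHermitian := by
  ext i j
  rw [Matrix.conjTranspose_apply, star_trivial]
  rcases eq_or_ne i j with rfl | h
  · rfl
  · rw [adjacency_apply_of_ne t T ω h, adjacency_apply_of_ne t T ω h.symm, min_comm, max_comm]

/-- The adjacency matrix has zero diagonal but the block matrix has `p` there; this is the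
correction by a multiple of the identity. -/
lemma adjacency_sub_blockMatrix {Ω : Type u} {n k : ℕ} (c : Fin n → Fin k) (p q : ℝ)
    (t : Fin n → Fin n → ℕ → Ω → ℝ) (T : ℝ) (ω : Ω) :
    adjacency t T ω - blockMatrix c p q =
      symMatrix (fun e => Function.extend pairEdge (centeredEdge c p q t T) 0 e ω) -
        p • (1 : Matrix (Fin n) (Fin n) ℝ) := by
  have hlt : ∀ i j (h : i < j), Function.extend pairEdge (centeredEdge c p q t T) 0 s(i, j) =
      centeredEdge c p q t T ⟨(i, j), h⟩ := fun i j h =>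
    pairEdge_injective.extend_apply _ _ (⟨(i, j), h⟩ : {p : Fin n × Fin n // p.1 < p.2})
  ext i j
  simp only [Matrix.sub_apply, Matrix.smul_apply, symMatrix, Matrix.of_apply, smul_eq_mul]
  rcases lt_trichotomy i j with h | rfl | h
  · rw [hlt i j h, adjacency_apply_of_ne t T ω h.ne, Matrix.one_apply_ne h.ne, centeredEdge,
      min_eq_left h.le, max_eq_right h.le]
    ring
  · rw [Function.extend_apply']
    · simp [adjacency, blockMatrix]
    · rintro ⟨⟨⟨a, b⟩, hab⟩, he⟩
      simp only [pairEdge, Sym2.eq_iff] at he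
      rcases he with ⟨rfl, rfl⟩ | ⟨rfl, rfl⟩ <;> exact lt_irrefl _ hab
  · rw [Sym2.eq_swap, hlt j i h, adjacency_apply_of_ne t T ω h.ne', Matrix.one_apply_ne h.ne',
      centeredEdge, min_eq_right h.le, max_eq_left h.le]
    simp only [blockMatrix, Matrix.of_apply, eq_comm (a := c i)]
    ring

/-- Concentration of the adjacency matrix around the block matrix of edge probabilities. -/
theorem measureReal_adjacency_close {Ω : Type u} [MeasurableSpace Ω] {P : Measure Ω}
    [IsProbabilityMeasure P] {n k : ℕ} {c : Fin n → Fin k} {μ₁ α₁ β₁ μ₂ α₂ β₂ T : ℝ}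
    {t : Fin n → Fin n → ℕ → Ω → ℝ} (hT : 0 < T) (hμ₁ : 0 < μ₁) (hμ₂ : 0 < μ₂)
    (h : IsCHIP P c (twoValued μ₁ μ₂) (twoValued α₁ α₂) (twoValued β₁ β₂) t) {p : ℕ} (hp : 0 < p)
    {q : ℝ} (hq₁ : 1 - Real.exp (-(μ₁ * T)) ≤ q) (hq₂ : 1 - Real.exp (-(μ₂ * T)) ≤ q) (hq : q ≤ 1)
    (hnq : n * q ≤ p) :
    1 - n * Real.exp (-p) ≤ P.real {ω | ∀ w, ‖Matrix.toEuclideanLin (adjacency t T ω -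
      blockMatrix c (1 - Real.exp (-(μ₁ * T))) (1 - Real.exp (-(μ₂ * T)))) w‖ ≤
        (√(normConst * p) + (1 - Real.exp (-(μ₁ * T)))) * ‖w‖} := by
  set p₁ := 1 - Real.exp (-(μ₁ * T)) with hp₁
  set p₂ := 1 - Real.exp (-(μ₂ * T)) with hp₂
  have hp₁0 : 0 ≤ p₁ := by
    rw [hp₁, sub_nonneg, Real.exp_le_one_iff]; nlinarith
  have hp₂0 : 0 ≤ p₂ := by
    rw [hp₂, sub_nonneg, Real.exp_le_one_iff]; nlinarith
  have hq0 : 0 ≤ q := hp₁0.trans hq₁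
  let y := centeredEdge c p₁ p₂ t T
  have hblock : ∀ i j, blockMatrix c p₁ p₂ i j =
      1 - Real.exp (-(twoValued μ₁ μ₂ (c i) (c j) * T)) := fun i j => by
    rw [← edgeProb_twoValued]; rfl
  have hb0 : ∀ i j, 0 ≤ blockMatrix c p₁ p₂ i j := fun i j => by
    simp only [blockMatrix, Matrix.of_apply]; split_ifs <;> assumption
  have hbq : ∀ i j, blockMatrix c p₁ p₂ i j ≤ q := fun i j => by
    simp only [blockMatrix, Matrix.of_apply]; split_ifs <;> assumption
  have hmeas : ∀ e, Measurable (y e) := fun e =>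
    ((h.hawkes _ _ e.2).measurable_hasEvent T).sub_const _
  have hint : ∀ e : {p : Fin n × Fin n // p.1 < p.2},
      ∫ ω, hasEvent T (fun l => t e.1.1 e.1.2 l ω) ∂P = blockMatrix c p₁ p₂ e.1.1 e.1.2 := fun e => by
    rw [(h.hawkes _ _ e.2).integral_hasEvent hT, hblock]
  have hyb : ∀ e ω, |y e ω| ≤ 1 := fun e ω => by
    have h1 := hb0 e.1.1 e.1.2
    have h2 := (hbq e.1.1 e.1.2).trans hq
    simp only [y, centeredEdge]
    rw [abs_le]
    rcases hasEvent_eq_zero_or_one T (fun l => t e.1.1 e.1.2 l ω) with h | h <;> rw [h] <;>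
      constructor <;> linarith
  have hind : iIndepFun y P :=
    h.indep.comp (fun e s => hasEvent T s - blockMatrix c p₁ p₂ e.1.1 e.1.2)
      fun e => (measurable_hasEvent T).sub_const _
  have hMF : MomentsFactor P (Function.extend pairEdge y 0) :=
    (momentsFactor_of_iIndepFun hind hmeas hyb).extend pairEdge_injective
  have hinteg : ∀ e : {p : Fin n × Fin n // p.1 < p.2},
      Integrable (fun ω => hasEvent T fun l => t e.1.1 e.1.2 l ω) P := fun e =>
    Integrable.of_bound ((h.hawkes _ _ e.2).measurable_hasEvent T).aestronglyMeasurable 1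
      (Eventually.of_forall fun ω => by
        rcases hasEvent_eq_zero_or_one T (fun l => t e.1.1 e.1.2 l ω) with h | h <;> simp [h])
  have hmean : ∀ e, ∫ ω, Function.extend pairEdge y 0 e ω ∂P = 0 := by
    intro e
    by_cases he : ∃ e', pairEdge e' = e
    · obtain ⟨e', rfl⟩ := he
      rw [pairEdge_injective.extend_apply]
      simp only [y, centeredEdge]
      rw [integral_sub (hinteg e') (integrable_const _), hint]
      simp
    · rw [Function.extend_apply' _ _ _ he]; simp
  have hmom : ∀ e k, 2 ≤ k → |∫ ω, Function.extend pairEdge y 0 e ω ^ k ∂P| ≤ q := by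
    intro e k hk
    by_cases he : ∃ e', pairEdge e' = e
    · obtain ⟨e', rfl⟩ := he
      rw [pairEdge_injective.extend_apply]
      exact (abs_integral_centered_pow_le ((h.hawkes _ _ e'.2).measurable_hasEvent T)
        (fun ω => hasEvent_eq_zero_or_one _ _) (hint e') (hb0 _ _) ((hbq _ _).trans hq) hk).trans
        (hbq _ _)
    · rw [Function.extend_apply' _ _ _ he]
      simp [show k ≠ 0 by omega, hq0]
  refine (measureReal_norm_symMatrix_le hp hMF hq0 hq hnq hmean hmom).trans
    (measureReal_mono fun ω hω w => ?_)
  rw [adjacency_sub_blockMatrix, map_sub, map_smul, LinearMap.sub_apply, LinearMap.smul_apply]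
  refine (norm_sub_le _ _).trans ?_
  rw [add_mul]
  refine add_le_add (hω w) ?_
  rw [norm_smul, Real.norm_of_nonneg hp₁0]
  simp


/-! ### The error bound in general -/

lemma ParamsOK.one_lt {K μ₁ α₁ β₁ μ₂ α₂ β₂ : ℝ} (h : ParamsOK K μ₁ α₁ β₁ μ₂ α₂ β₂) : 1 < K := by
  have hβ : 0 < β₂ := h.alpha₂_pos.trans h.alpha₂_lt
  have hb : 0 < 1 - α₂ / β₂ := by rw [sub_pos, div_lt_one hβ]; exact h.alpha₂_lt
  have hν : 0 < nu μ₂ α₂ β₂ := div_pos h.mu₂_pos hb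
  by_contra hK
  have := h.nu_lt.trans_le h.nu_le
  nlinarith

/-- Comparability of the `ν`s and the `σ`s forces comparability of the baseline rates. -/
lemma ParamsOK.mu₂_le {K μ₁ α₁ β₁ μ₂ α₂ β₂ : ℝ} (h : ParamsOK K μ₁ α₁ β₁ μ₂ α₂ β₂) :
    μ₂ ≤ K * μ₁ := by
  have hβ₁ : 0 < β₁ := h.alpha₁_pos.trans h.alpha₁_lt
  have hβ₂ : 0 < β₂ := h.alpha₂_pos.trans h.alpha₂_lt
  have ha : 0 < 1 - α₁ / β₁ := by rw [sub_pos, div_lt_one hβ₁]; exact h.alpha₁_lt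
  have hb : 0 < 1 - α₂ / β₂ := by rw [sub_pos, div_lt_one hβ₂]; exact h.alpha₂_lt
  have hK : 0 < K := zero_lt_one.trans h.one_lt
  have hμ₁ := h.mu₁_pos
  have hμ₂ := h.mu₂_pos
  have h1 := h.nu_lt
  have h2 := h.sigma_le
  unfold nu at h1
  unfold sigma at h2
  set a := 1 - α₁ / β₁
  set b := 1 - α₂ / β₂
  rw [div_lt_div_iff₀ hb ha] at h1
  have h3 : μ₁ / a ^ 3 ≤ K ^ 2 * (μ₂ / b ^ 3) := by
    have h4 := pow_le_pow_left₀ (Real.sqrt_nonneg _) h2 2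
    rwa [mul_pow, Real.sq_sqrt (by positivity), Real.sq_sqrt (by positivity)] at h4
  rw [← mul_div_assoc, div_le_div_iff₀ (by positivity) (by positivity)] at h3
  -- `h1` reads `μ₂ a < μ₁ b` and `h3` reads `μ₁ b ^ 3 ≤ K ^ 2 μ₂ a ^ 3`. If `K a < b`, multiplying
  -- its square with `h1` contradicts `h3`. Then `h1` gives `μ₂ a < K μ₁ a`.
  have h5 : b ≤ K * a := by
    by_contra hlt
    push Not at hlt
    have h6 : (K * a) ^ 2 < b ^ 2 := pow_lt_pow_left₀ hlt (by positivity) two_ne_zero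
    have h7 : K ^ 2 * a ^ 2 * (μ₂ * a) < b ^ 2 * (μ₁ * b) := by
      rw [← mul_pow]
      exact mul_lt_mul'' h6 h1 (by positivity) (by positivity)
    nlinarith
  have h8 : μ₂ * a < K * μ₁ * a := by nlinarith
  exact (lt_of_mul_lt_mul_right h8 ha.le).le

/-- Bernoulli's inequality for `exp (-x)` to the real power `K`. -/
lemma one_sub_exp_neg_mul_le {K x : ℝ} (hK : 1 ≤ K) :
    1 - Real.exp (-(K * x)) ≤ K * (1 - Real.exp (-x)) := by
  have h := one_add_mul_self_le_rpow_one_add (s := Real.exp (-x) - 1)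
    (by linarith [Real.exp_pos (-x)]) hK
  have h2 : (1 + (Real.exp (-x) - 1)) ^ K = Real.exp (-(K * x)) := by
    rw [add_sub_cancel, ← Real.exp_mul]; ring_nf
  rw [h2] at h
  linarith

/-- The constant in the general bound. -/
def errorConst (c₀ r ε K : ℝ) : ℝ :=
  64 * (2 + ε) * (K * (2 * normConst * (1 + (r + 1) / c₀ + 1 / (c₀ * Real.log 2)) + 2))

lemma errorConst_pos {c₀ r ε K : ℝ} (hc₀ : 0 < c₀) (hr : 0 < r) (hε : 0 < ε) (hK : 0 < K) :
    0 < errorConst c₀ r ε K := by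
  have := normConst_pos
  have := Real.log_pos one_lt_two
  unfold errorConst
  positivity

lemma misclusteringError_le_of_subsingleton {n k : ℕ} (hk : k ≤ 1) (c z : Fin n → Fin k) :
    misclusteringError c z ≤ 0 := by
  have : Subsingleton (Fin k) := Fin.subsingleton_iff_le_one.2 hk
  refine (misclusteringError_le_of_perm c z 1).trans (le_of_eq ?_)
  rw [Finset.sum_eq_zero, mul_zero]
  intro i _
  rw [if_neg]
  simpa using Subsingleton.elim _ _

/-- The noise is governed by the larger probability `q`, the claimed bound by the one within
communities; `q ≤ K p` trades one for the other. -/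
lemma sqrt_add_sq_le {C N p q n K M : ℝ} (hC : 0 ≤ C) (hN : 0 ≤ N) (hp : 0 ≤ p) (hpq : p ≤ q)
    (hq : q ≤ 1) (hn : 1 ≤ n) (hNM : N ≤ M * (n * q)) (hM : 0 ≤ M) (hqK : q ≤ K * p) :
    (√(C * N) + p) ^ 2 ≤ K * (2 * C * M + 2) * (n * p) := by
  have h1 : (√(C * N) + p) ^ 2 ≤ 2 * (C * N) + 2 * p ^ 2 := by
    have h2 := Real.sq_sqrt (mul_nonneg hC hN)
    linarith [sq_nonneg (√(C * N) - p), add_sq (√(C * N)) p, sub_sq (√(C * N)) p]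
  have h3 : p ^ 2 ≤ n * q := by
    calc p ^ 2 = p * p := sq p
      _ ≤ 1 * q := mul_le_mul (hpq.trans hq) hpq hp zero_le_one
      _ ≤ n * q := mul_le_mul_of_nonneg_right hn (hp.trans hpq)
  have h4 : C * N ≤ C * (M * (n * q)) := mul_le_mul_of_nonneg_left hNM hC
  have h5 : (2 * C * M + 2) * (n * q) ≤ (2 * C * M + 2) * (n * (K * p)) := by gcongr
  linarith

theorem spectral_clustering_error_bound {c₀ r ε K : ℝ} (hc₀ : 0 < c₀) (hr : 0 < r) (hε : 0 < ε)
    {n k : ℕ} {c : Fin n → Fin k} {μ₁ α₁ β₁ μ₂ α₂ β₂ T : ℝ}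
    {Ω : Type u} [MeasurableSpace Ω] {P : Measure Ω} [IsProbabilityMeasure P]
    {t : Fin n → Fin n → ℕ → Ω → ℝ} (hn : 0 < n) (hT : 0 < T)
    (hpar : ParamsOK K μ₁ α₁ β₁ μ₂ α₂ β₂) (hμ : μ₁ ≠ μ₂)
    (hdense : c₀ * Real.log n ≤ n * (1 - Real.exp (-(max μ₁ μ₂ * T))))
    (hchip : IsSimplifiedCHIP P c μ₁ α₁ β₁ μ₂ α₂ β₂ t) :
    1 - (n : ℝ) ^ (-r) ≤ P.real {ω | ∀ z : Fin n → Fin k,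
      IsSpectralClustering ε (adjacency t T ω) z → misclusteringError c z ≤
        errorConst c₀ r ε K * ((k : ℝ) ^ 2 / n * ((1 - Real.exp (-(μ₁ * T))) /
          (Real.exp (-(μ₂ * T)) - Real.exp (-(μ₁ * T))) ^ 2))} := by
  have hK1 := hpar.one_lt
  have hK : 0 < K := zero_lt_one.trans hK1
  have hμ₁ := hpar.mu₁_pos
  have hμ₂ := hpar.mu₂_pos
  have hC := normConst_pos
  have hlog2 := Real.log_pos one_lt_two
  have hexp : ∀ μ : ℝ, 0 < μ → Real.exp (-(μ * T)) < 1 := fun μ h => by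
    rw [Real.exp_lt_one_iff]; nlinarith
  -- For `n = 1` the claimed probability is `0`. From `n ≥ 2` on, `log n` is bounded below, which is
  -- needed to absorb the rounding of the exponent.
  rcases Nat.lt_or_ge n 2 with hn1 | hn2
  · have : n = 1 := by omega
    simp only [this, Nat.cast_one, Real.one_rpow, sub_self]
    exact measureReal_nonneg
  have hn' : (0 : ℝ) < n := by exact_mod_cast hn
  have hn2' : (2 : ℝ) ≤ n := by exact_mod_cast hn2
  set p₁ := 1 - Real.exp (-(μ₁ * T)) with hp₁
  set p₂ := 1 - Real.exp (-(μ₂ * T)) with hp₂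
  set q := 1 - Real.exp (-(max μ₁ μ₂ * T)) with hq
  have hp₁0 : 0 < p₁ := sub_pos.2 (hexp μ₁ hμ₁)
  have hp₂0 : 0 < p₂ := sub_pos.2 (hexp μ₂ hμ₂)
  have hdiff : p₁ - p₂ = Real.exp (-(μ₂ * T)) - Real.exp (-(μ₁ * T)) := by rw [hp₁, hp₂]; ring
  have hp₁₂ : p₁ ≠ p₂ := by
    intro h
    have h1 : Real.exp (-(μ₁ * T)) = Real.exp (-(μ₂ * T)) := by linarith
    have h2 := Real.exp_injective h1
    exact hμ (mul_right_cancel₀ hT.ne' (neg_injective h2))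
  have hmono : ∀ {μ ν : ℝ}, μ ≤ ν → 1 - Real.exp (-(μ * T)) ≤ 1 - Real.exp (-(ν * T)) :=
    fun h => sub_le_sub_left (Real.exp_le_exp.2 (neg_le_neg (mul_le_mul_of_nonneg_right h hT.le))) _
  have hp₁q : p₁ ≤ q := hmono (le_max_left _ _)
  have hp₂q : p₂ ≤ q := hmono (le_max_right _ _)
  have hq1 : q ≤ 1 := by rw [hq]; linarith [Real.exp_pos (-(max μ₁ μ₂ * T))]
  have hqK : q ≤ K * p₁ := by
    refine (hmono (max_le (le_mul_of_one_le_left hμ₁.le hK1.le) hpar.mu₂_le)).trans ?_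
    rw [mul_assoc]
    exact one_sub_exp_neg_mul_le hK1.le
  set d := n * q with hd
  have hd0 : c₀ * Real.log 2 ≤ d := by
    refine le_trans ?_ hdense
    gcongr
  have hdpos : 0 < d := lt_of_lt_of_le (by positivity) hd0
  -- The summand `1` ensures `n q ≤ N`; the other ensures `(r + 1) log n ≤ N`, so that `n exp (-N) ≤
  -- n ^ (-r)`.
  set M := 1 + (r + 1) / c₀ with hM
  have hM1 : 1 ≤ M := by rw [hM]; linarith [show 0 < (r + 1) / c₀ by positivity]
  set N := ⌈M * d⌉₊ with hN
  have hN0 : 0 < N := Nat.ceil_pos.2 (by positivity)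
  have hMN : M * d ≤ N := Nat.le_ceil _
  have hdN : n * q ≤ N := by nlinarith
  have hlogN : (r + 1) * Real.log n ≤ N := by
    refine le_trans ?_ hMN
    calc (r + 1) * Real.log n = (r + 1) / c₀ * (c₀ * Real.log n) := by field_simp
      _ ≤ (r + 1) / c₀ * d := by gcongr
      _ ≤ M * d := by gcongr; rw [hM]; linarith
  have hNd : (N : ℝ) ≤ (M + 1 / (c₀ * Real.log 2)) * d := by
    have h1 := (Nat.ceil_lt_add_one (show 0 ≤ M * d by positivity)).le
    -- The rounding error is at most `1`, which is a bounded multiple of `d`.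
    have h2 : 1 ≤ 1 / (c₀ * Real.log 2) * d := by
      rw [div_mul_eq_mul_div, one_mul, one_le_div (by positivity)]; exact hd0
    rw [add_mul]
    linarith
  have hprob : n * Real.exp (-N) ≤ (n : ℝ) ^ (-r) := by
    calc n * Real.exp (-N) ≤ n * Real.exp (-((r + 1) * Real.log n)) := by gcongr
      _ = (n : ℝ) ^ (-r) := by
        rw [Real.rpow_def_of_pos hn', show Real.log n * -r = Real.log n + -((r + 1) * Real.log n)
          by ring, Real.exp_add, Real.exp_log hn']
  refine (sub_le_sub_left hprob 1).trans ((measureReal_adjacency_close hT hμ₁ hμ₂ hchip.2 hN0 hp₁q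
    hp₂q hq1 hdN).trans (measureReal_mono fun ω hω z hz => ?_))
  rw [← hdiff]
  rcases Nat.lt_or_ge k 2 with hk | hk
  · refine (misclusteringError_le_of_subsingleton (by omega) c z).trans ?_
    have := errorConst_pos hc₀ hr hε hK
    positivity
  have hk' : (0 : ℝ) < k := by exact_mod_cast (by omega : 0 < k)
  have hD : p₁ - p₂ ≠ 0 := sub_ne_zero.2 hp₁₂
  refine (misclusteringError_le_of_close hchip.1 hn hk hp₁0 hp₂0 hp₁₂ (adjacency_isHermitian t T ω)
    (by positivity) hω hε hz).trans ?_
  set δ := √(normConst * N) + p₁ with hδ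
  have hδ2 : δ ^ 2 ≤ K * (2 * normConst * (M + 1 / (c₀ * Real.log 2)) + 2) * (n * p₁) :=
    sqrt_add_sq_le hC.le (Nat.cast_nonneg N) hp₁0.le hp₁q hq1 (by linarith) hNd (by positivity) hqK
  calc 64 * (2 + ε) * (δ / (n / k * |p₁ - p₂|)) ^ 2
      = 64 * (2 + ε) * (δ ^ 2 / (n / k * |p₁ - p₂|) ^ 2) := by rw [div_pow]
    _ ≤ 64 * (2 + ε) * (K * (2 * normConst * (M + 1 / (c₀ * Real.log 2)) + 2) * (n * p₁) /
          (n / k * |p₁ - p₂|) ^ 2) := by gcongr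
    _ = _ := by
      rw [mul_pow, sq_abs, errorConst, ← hM]
      field_simp


/-! ### The sparse regime -/

lemma half_le_one_sub_exp_neg {x : ℝ} (h0 : 0 ≤ x) (h1 : x ≤ 1) : x / 2 ≤ 1 - Real.exp (-x) := by
  have h2 := Real.add_one_le_exp x
  have h3 : Real.exp (-x) * Real.exp x = 1 := by rw [← Real.exp_add]; simp
  have h4 := Real.exp_pos (-x)
  nlinarith

lemma one_sub_exp_neg_le (x : ℝ) : 1 - Real.exp (-x) ≤ x := by
  linarith [Real.add_one_le_exp (-x)]

/-- Factor out the larger exponential, which lies between `1 / 2` and `1`; the rest is `1 - exp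
(-x)` at `x = |a - b|`, between `x / 2` and `x`. -/
lemma abs_exp_neg_sub_bounds {a b : ℝ} (ha : 0 ≤ a) (hb : 0 ≤ b) (ha' : a ≤ 1 / 2)
    (hb' : b ≤ 1 / 2) :
    |a - b| / 4 ≤ |Real.exp (-b) - Real.exp (-a)| ∧ |Real.exp (-b) - Real.exp (-a)| ≤ |a - b| := by
  wlog h : b ≤ a generalizing a b
  · rw [abs_sub_comm a, abs_sub_comm (Real.exp _)]
    exact this hb ha hb' ha' (le_of_not_ge h)
  have h1 : Real.exp (-b) - Real.exp (-a) = Real.exp (-b) * (1 - Real.exp (-(a - b))) := by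
    rw [mul_sub, ← Real.exp_add]; ring_nf
  have h2 := half_le_one_sub_exp_neg (sub_nonneg.2 h) (by linarith)
  have h3 := one_sub_exp_neg_le (a - b)
  have h4 : Real.exp (-b) ≤ 1 := Real.exp_le_one_iff.2 (by linarith)
  have h5 : 1 / 2 ≤ Real.exp (-b) := by linarith [Real.add_one_le_exp (-b)]
  have h6 : 0 ≤ 1 - Real.exp (-(a - b)) := by linarith
  rw [h1, abs_of_nonneg (sub_nonneg.2 h), abs_of_nonneg (by positivity)]
  constructor <;> nlinarith

lemma sparse_ratio_bounds {a b : ℝ} (ha : 0 < a) (hb : 0 < b) (hab : a ≠ b) (ha' : a ≤ 1 / 2)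
    (hb' : b ≤ 1 / 2) :
    (1 - Real.exp (-a)) / (Real.exp (-b) - Real.exp (-a)) ^ 2 ≤ 16 * (a / (a - b) ^ 2) ∧
      a / (a - b) ^ 2 ≤ 2 * ((1 - Real.exp (-a)) / (Real.exp (-b) - Real.exp (-a)) ^ 2) := by
  obtain ⟨h1, h2⟩ := abs_exp_neg_sub_bounds ha.le hb.le ha' hb'
  have h3 := half_le_one_sub_exp_neg ha.le (by linarith)
  have h4 := one_sub_exp_neg_le a
  have h5 : 0 < |a - b| := abs_pos.2 (sub_ne_zero.2 hab)
  rw [← sq_abs (a - b), ← sq_abs (Real.exp (-b) - Real.exp (-a))]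
  have h6 : 0 < |Real.exp (-b) - Real.exp (-a)| := lt_of_lt_of_le (by positivity) h1
  constructor
  · calc (1 - Real.exp (-a)) / |Real.exp (-b) - Real.exp (-a)| ^ 2 ≤ a / (|a - b| / 4) ^ 2 := by
          gcongr
      _ = 16 * (a / |a - b| ^ 2) := by field_simp; norm_num
  · calc a / |a - b| ^ 2 = 2 * (a / 2 / |a - b| ^ 2) := by ring
      _ ≤ _ := by
        have h7 : 0 ≤ 1 - Real.exp (-a) := by linarith
        gcongr

lemma sparse_bound_eq {n k T μ₁ μ₂ : ℝ} (hn : n ≠ 0) (hk : k ≠ 0) (hT : T ≠ 0) (hμ : μ₁ ≠ μ₂) :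
    n * T * μ₁ / ((n / k) ^ 2 * (μ₁ - μ₂) ^ 2 * T ^ 2) =
      k ^ 2 / n * (μ₁ * T / (μ₁ * T - μ₂ * T) ^ 2) := by
  have h := sub_ne_zero.2 hμ
  rw [← sub_mul]
  field_simp

lemma sparse_bound_eq' {n k T μ₁ μ₂ : ℝ} (hn : n ≠ 0) (hk : k ≠ 0) (hT : T ≠ 0) (hμ : μ₁ ≠ μ₂) :
    n * T * μ₁ / ((n / k) ^ 2 * (μ₁ - μ₂) ^ 2 * T ^ 2) =
      k ^ 2 / (n * T) * (μ₁ / (μ₁ - μ₂) ^ 2) := by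
  have h := sub_ne_zero.2 hμ
  field_simp

/-- Two-sided comparison of the general and the sparse error bound. -/
lemma general_sparse_bounds {n k T μ₁ μ₂ : ℝ} (hn : 0 < n) (hk : 0 < k) (hT : 0 < T)
    (hμ₁ : 0 < μ₁) (hμ₂ : 0 < μ₂) (hμ : μ₁ ≠ μ₂) (h₁ : μ₁ * T ≤ 1 / 2) (h₂ : μ₂ * T ≤ 1 / 2) :
    k ^ 2 / n * ((1 - Real.exp (-(μ₁ * T))) / (Real.exp (-(μ₂ * T)) - Real.exp (-(μ₁ * T))) ^ 2) ≤
      16 * (n * T * μ₁ / ((n / k) ^ 2 * (μ₁ - μ₂) ^ 2 * T ^ 2)) ∧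
    n * T * μ₁ / ((n / k) ^ 2 * (μ₁ - μ₂) ^ 2 * T ^ 2) ≤ 2 * (k ^ 2 / n *
      ((1 - Real.exp (-(μ₁ * T))) / (Real.exp (-(μ₂ * T)) - Real.exp (-(μ₁ * T))) ^ 2)) := by
  obtain ⟨h3, h4⟩ := sparse_ratio_bounds (mul_pos hμ₁ hT) (mul_pos hμ₂ hT)
    (fun h => hμ (mul_right_cancel₀ hT.ne' h)) h₁ h₂
  rw [sparse_bound_eq hn.ne' hk.ne' hT.ne' hμ]
  have h5 : 0 ≤ k ^ 2 / n := by positivity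
  constructor
  · calc _ ≤ k ^ 2 / n * (16 * (μ₁ * T / (μ₁ * T - μ₂ * T) ^ 2)) := mul_le_mul_of_nonneg_left h3 h5
      _ = _ := by ring
  · calc _ ≤ k ^ 2 / n * (2 * ((1 - Real.exp (-(μ₁ * T))) /
          (Real.exp (-(μ₂ * T)) - Real.exp (-(μ₁ * T))) ^ 2)) := mul_le_mul_of_nonneg_left h4 h5
      _ = _ := by ring

lemma general_bound_nonneg {n k T μ₁ μ₂ : ℝ} (hn : 0 < n) (hT : 0 < T) (hμ₁ : 0 < μ₁) :
    0 ≤ k ^ 2 / n *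
      ((1 - Real.exp (-(μ₁ * T))) / (Real.exp (-(μ₂ * T)) - Real.exp (-(μ₁ * T))) ^ 2) := by
  have : 0 ≤ 1 - Real.exp (-(μ₁ * T)) := by
    rw [sub_nonneg, Real.exp_le_one_iff, neg_nonpos]; positivity
  positivity

/-! ### The dense regime -/

/-- The difference of two community vectors is an eigenvector for `n / k (p - q)`. The spectrum is
finite, so the infimum is attained at a nonzero eigenvalue and is positive. -/
lemma lambdaMin_blockMatrix {n k : ℕ} {c : Fin n → Fin k} (hc : Balanced c) (hn : 0 < n)
    (hk : 2 ≤ k) {p q : ℝ} (hpq : p ≠ q) :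
    0 < lambdaMin (blockMatrix c p q) ∧ lambdaMin (blockMatrix c p q) ≤ n / k * |p - q| := by
  have hn' : (0 : ℝ) < n := by exact_mod_cast hn
  have hk' : (0 : ℝ) < k := by exact_mod_cast (by omega : 0 < k)
  have hD : p - q ≠ 0 := sub_ne_zero.2 hpq
  have hV := orthonormal_communityVec hc hn
  set S := {y | ∃ x : ℝ, Module.End.HasEigenvalue (Matrix.toLin' (blockMatrix c p q)) x ∧
    x ≠ 0 ∧ y = |x|} with hS
  have hev : Module.End.HasEigenvalue (Matrix.toLin' (blockMatrix c p q)) (n / k * (p - q)) := by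
    let a : Fin k := ⟨0, by omega⟩
    let b : Fin k := ⟨1, by omega⟩
    have hab : a ≠ b := by simp [a, b]
    have hw : communityVec c a - communityVec c b ≠ 0 := fun h => by
      have h2 : ‖communityVec c a - communityVec c b‖ ^ 2 = 2 := by
        rw [norm_sub_sq_real, hV.norm_eq_one, hV.norm_eq_one, hV.inner_eq_zero hab]; norm_num
      rw [h] at h2
      simp at h2
    have hBw : Matrix.toEuclideanLin (blockMatrix c p q) (communityVec c a - communityVec c b) =
        (n / k * (p - q) : ℝ) • (communityVec c a - communityVec c b) := by
      rw [toEuclideanLin_blockMatrix hn]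
      simp only [inner_sub_right, Finset.sum_sub_distrib, orthonormal_iff_ite.1 hV]
      simp [mul_sub, sub_smul, smul_sub]
    refine Module.End.hasEigenvalue_of_hasEigenvector
      (x := (communityVec c a - communityVec c b).ofLp) ⟨?_, fun h => hw ?_⟩
    · rw [Module.End.mem_eigenspace_iff]
      have := congrArg WithLp.ofLp hBw
      simpa [Matrix.toLpLin_apply] using this
    · exact WithLp.ofLp_injective 2 h
  have hmem : n / k * |p - q| ∈ S :=
    ⟨_, hev, mul_ne_zero (by positivity) hD, by
      rw [abs_mul, abs_of_nonneg (show 0 ≤ (n : ℝ) / k by positivity)]⟩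
  have hfin : S.Finite := by
    refine ((Module.End.finite_hasEigenvalue
      (Matrix.toLin' (blockMatrix c p q))).image fun x => |x|).subset ?_
    rintro _ ⟨x, hx, -, rfl⟩
    exact ⟨x, hx, rfl⟩
  obtain ⟨x, -, hx0, hx⟩ := Set.Nonempty.csInf_mem ⟨_, hmem⟩ hfin
  refine ⟨?_, csInf_le hfin.bddBelow hmem⟩
  show 0 < sInf S
  rw [hx]
  exact abs_pos.2 hx0

theorem tendsto_generalBound {ε C c₀ : ℝ} (hε : 0 < ε) (hC : 0 < C)
    {n k : ℕ} {c : Fin n → Fin k} (hk : 2 ≤ k) (hn : 0 < n) (hc : Balanced c)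
    {ι : Type v} {F : Filter ι} {μ₁ μ₂ T : ι → ℝ} (hT : ∀ s, 0 < T s) (hμ : ∀ s, μ₁ s ≠ μ₂ s)
    (h₁ : Tendsto (fun s => μ₁ s * T s) F atTop) (h₂ : Tendsto (fun s => μ₂ s * T s) F atTop) :
    Tendsto (fun s => generalBound ε C c₀ c (twoValued (μ₁ s) (μ₂ s)) (T s)) F atTop := by
  have hn' : (0 : ℝ) < n := by exact_mod_cast hn
  have hk' : (0 : ℝ) < k := by exact_mod_cast (by omega : 0 < k)
  let p : ι → ℝ := fun s => 1 - Real.exp (-(μ₁ s * T s))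
  let q : ι → ℝ := fun s => 1 - Real.exp (-(μ₂ s * T s))
  have hpq : ∀ s, p s ≠ q s := fun s h => by
    have h1 : Real.exp (-(μ₁ s * T s)) = Real.exp (-(μ₂ s * T s)) := by
      simp only [p, q] at h; linarith
    exact hμ s (mul_right_cancel₀ (hT s).ne' (neg_injective (Real.exp_injective h1)))
  have hlim : ∀ {μ : ι → ℝ}, Tendsto (fun s => μ s * T s) F atTop →
      Tendsto (fun s => 1 - Real.exp (-(μ s * T s))) F (𝓝 1) := fun h => by
    simpa using (tendsto_const_nhds (x := (1 : ℝ))).sub (Real.tendsto_exp_neg_atTop_nhds_zero.comp h)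
  let L : ι → ℝ := fun s => lambdaMin (blockMatrix c (p s) (q s))
  have hL0 : ∀ s, 0 < L s := fun s => (lambdaMin_blockMatrix hc hn hk (hpq s)).1
  have hLlim : Tendsto L F (𝓝 0) := by
    have h3 : Tendsto (fun s => (n : ℝ) / k * |p s - q s|) F (𝓝 0) := by
      have h4 := (((hlim h₁).sub (hlim h₂)).abs).const_mul ((n : ℝ) / k)
      rwa [sub_self, abs_zero, mul_zero] at h4
    exact squeeze_zero (fun s => (hL0 s).le)
      (fun s => (lambdaMin_blockMatrix hc hn hk (hpq s)).2) h3
  -- Positivity of `L` matters: at `0` the inverse would take the default value `0` instead of being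
  -- large.
  have hinv : Tendsto (fun s => (L s ^ 2)⁻¹) F atTop := by
    refine Tendsto.inv_tendsto_nhdsGT_zero (tendsto_nhdsWithin_iff.2 ⟨?_, ?_⟩)
    · simpa using hLlim.pow 2
    · exact Eventually.of_forall fun s => pow_pos (hL0 s) 2
  have hmc : (0 : ℝ) < maxCommunity c := by
    have a : Fin k := ⟨0, by omega⟩
    have h3 : communitySize c a ≤ maxCommunity c :=
      Finset.le_sup (f := communitySize c) (Finset.mem_univ a)
    have h4 : 0 < communitySize c a := Nat.pos_of_ne_zero fun h => by
      have := hc a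
      rw [h, mul_zero] at this
      omega
    exact_mod_cast h4.trans_le h3
  have hΔ : ∀ᶠ s in F, (n : ℝ) * (1 / 2) ≤ Delta c₀ c (twoValued (μ₁ s) (μ₂ s)) (T s) := by
    filter_upwards [(hlim h₁).eventually (lt_mem_nhds (show (1 / 2 : ℝ) < 1 by norm_num))] with s hs
    refine le_max_of_le_left ?_
    gcongr
    let i : Fin n := ⟨0, hn⟩
    refine hs.le.trans (le_trans (le_of_eq ?_)
      (le_ciSup (f := fun p : Fin n × Fin n => edgeProb c (twoValued (μ₁ s) (μ₂ s)) (T s) p.1 p.2)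
        (Set.finite_range _).bddAbove (i, i)))
    simp [edgeProb, twoValued]
  set κ : ℝ := 64 * (2 + ε) * (maxCommunity c * k * C * (n * (1 / 2)) / n) with hκ
  have hκ0 : 0 < κ := by positivity
  refine tendsto_atTop_mono' F ?_ (hinv.const_mul_atTop hκ0)
  filter_upwards [hΔ] with s hs
  have hL : lambdaMin (edgeProb c (twoValued (μ₁ s) (μ₂ s)) (T s)) = L s := by
    rw [edgeProb_twoValued]
  have hLs := hL0 s
  rw [generalBound, hL, hκ]
  calc 64 * (2 + ε) * (maxCommunity c * k * C * (n * (1 / 2)) / n) * (L s ^ 2)⁻¹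
      = 64 * (2 + ε) * (maxCommunity c * k * C * (n * (1 / 2)) / (n * L s ^ 2)) := by
        field_simp
    _ ≤ _ := by gcongr

end CHIP

end

/-! ### The error bounds and the dense limit. -/

theorem corollary1 :
    -- the two error bounds, with a constant that depends only on `c₀, r, ε, K`
    (∀ c₀ r ε K : ℝ, 0 < c₀ → 0 < r → 0 < ε → 0 < K → ∃ C : ℝ, 0 < C ∧
      -- the bound in general
      (∀ (n k : ℕ) (c : Fin n → Fin k) (μ₁ α₁ β₁ μ₂ α₂ β₂ T : ℝ)
        (Ω : Type u) [MeasurableSpace Ω] (P : Measure Ω) [IsProbabilityMeasure P]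
        (t : Fin n → Fin n → ℕ → Ω → ℝ),
        0 < n → 0 < T → CHIP.ParamsOK K μ₁ α₁ β₁ μ₂ α₂ β₂ → μ₁ ≠ μ₂ →
        c₀ * Real.log n ≤ n * (1 - Real.exp (-(max μ₁ μ₂ * T))) →
        CHIP.IsSimplifiedCHIP P c μ₁ α₁ β₁ μ₂ α₂ β₂ t →
        1 - (n : ℝ) ^ (-r) ≤
          P.real {ω | ∀ z : Fin n → Fin k,
            CHIP.IsSpectralClustering ε (CHIP.adjacency t T ω) z →
            CHIP.misclusteringError c z ≤
              C * ((k : ℝ) ^ 2 / n * ((1 - Real.exp (-(μ₁ * T))) /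
                (Real.exp (-(μ₂ * T)) - Real.exp (-(μ₁ * T))) ^ 2))}) ∧
      -- the sparse regime
      (∀ (ι : Type v) (F : Filter ι) (n k : ι → ℕ) (c : ∀ s, Fin (n s) → Fin (k s))
        (μ₁ α₁ β₁ μ₂ α₂ β₂ T : ι → ℝ)
        (Ω : ι → Type u) [∀ s, MeasurableSpace (Ω s)] (P : ∀ s, Measure (Ω s))
        [∀ s, IsProbabilityMeasure (P s)] (t : ∀ s, Fin (n s) → Fin (n s) → ℕ → Ω s → ℝ),
        (∀ s, 0 < n s) → (∀ s, 0 < T s) →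
        (∀ s, CHIP.ParamsOK K (μ₁ s) (α₁ s) (β₁ s) (μ₂ s) (α₂ s) (β₂ s)) →
        (∀ s, μ₁ s ≠ μ₂ s) →
        (∀ s, c₀ * Real.log (n s) ≤ n s * (1 - Real.exp (-(max (μ₁ s) (μ₂ s) * T s)))) →
        (∀ s, CHIP.IsSimplifiedCHIP (P s) (c s) (μ₁ s) (α₁ s) (β₁ s) (μ₂ s) (α₂ s) (β₂ s)
          (t s)) →
        Tendsto (fun s => μ₁ s * T s) F (𝓝 0) → Tendsto (fun s => μ₂ s * T s) F (𝓝 0) →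
        (∀ᶠ s in F, 1 - (n s : ℝ) ^ (-r) ≤
          (P s).real {ω | ∀ z : Fin (n s) → Fin (k s),
            CHIP.IsSpectralClustering ε (CHIP.adjacency (t s) (T s) ω) z →
            CHIP.misclusteringError (c s) z ≤
              C * (n s * T s * μ₁ s /
                (((n s : ℝ) / k s) ^ 2 * (μ₁ s - μ₂ s) ^ 2 * T s ^ 2))}) ∧
        ((fun s => (k s : ℝ) ^ 2 / n s * ((1 - Real.exp (-(μ₁ s * T s))) /
            (Real.exp (-(μ₂ s * T s)) - Real.exp (-(μ₁ s * T s))) ^ 2)) =Θ[F]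
          fun s => n s * T s * μ₁ s /
            (((n s : ℝ) / k s) ^ 2 * (μ₁ s - μ₂ s) ^ 2 * T s ^ 2)) ∧
        ((fun s => n s * T s * μ₁ s /
            (((n s : ℝ) / k s) ^ 2 * (μ₁ s - μ₂ s) ^ 2 * T s ^ 2)) =Θ[F]
          fun s => (k s : ℝ) ^ 2 / (n s * T s) * (μ₁ s / (μ₁ s - μ₂ s) ^ 2)))) ∧
    -- the dense regime, for fixed `n`, `k`: the general bound explodes, so that, as a bound for
    -- an error rate, it becomes `1`
    (∀ (ε C c₀ : ℝ), 0 < ε → 0 < C → 0 < c₀ →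
      ∀ (n k : ℕ) (c : Fin n → Fin k), 2 ≤ k → 0 < n → CHIP.Balanced c →
      ∀ (ι : Type v) (F : Filter ι) (μ₁ μ₂ T : ι → ℝ),
        (∀ s, 0 < T s) → (∀ s, 0 < μ₁ s) → (∀ s, 0 < μ₂ s) → (∀ s, μ₁ s ≠ μ₂ s) →
        Tendsto (fun s => μ₁ s * T s) F atTop → Tendsto (fun s => μ₂ s * T s) F atTop →
        Tendsto (fun s => CHIP.generalBound ε C c₀ c (CHIP.twoValued (μ₁ s) (μ₂ s)) (T s))
          F atTop ∧
        Tendsto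
          (fun s => min 1 (CHIP.generalBound ε C c₀ c (CHIP.twoValued (μ₁ s) (μ₂ s)) (T s)))
          F (𝓝 1)) := by
  refine ⟨fun c₀ r ε K hc₀ hr hε hK => ?_, ?_⟩
  · have hE := CHIP.errorConst_pos hc₀ hr hε hK
    -- One constant must serve both regimes; for `μ₁ T, μ₂ T ≤ 1 / 2` the general expression is at
    -- most `16` times the sparse one.
    refine ⟨16 * CHIP.errorConst c₀ r ε K, by positivity, ?_, ?_⟩
    · intro n k c μ₁ α₁ β₁ μ₂ α₂ β₂ T Ω _ P _ t hn hT hpar hμ hdense hchip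
      refine (CHIP.spectral_clustering_error_bound hc₀ hr hε hn hT hpar hμ hdense hchip).trans
        (measureReal_mono fun ω hω z hz => (hω z hz).trans ?_)
      have hn' : (0 : ℝ) < n := by exact_mod_cast hn
      exact mul_le_mul_of_nonneg_right (by linarith)
        (CHIP.general_bound_nonneg hn' hT hpar.mu₁_pos)
    · intro ι F n k c μ₁ α₁ β₁ μ₂ α₂ β₂ T Ω _ P _ t hn hT hpar hμ hdense hchip h₁ h₂
      have hn' : ∀ s, (0 : ℝ) < n s := fun s => by exact_mod_cast hn s
      have hk' : ∀ s, (0 : ℝ) < k s := fun s => by exact_mod_cast (c s ⟨0, hn s⟩).pos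
      have hsmall : ∀ᶠ s in F, μ₁ s * T s ≤ 1 / 2 ∧ μ₂ s * T s ≤ 1 / 2 := by
        have h : (0 : ℝ) < 1 / 2 := by norm_num
        filter_upwards [h₁.eventually (gt_mem_nhds h), h₂.eventually (gt_mem_nhds h)] with s h3 h4
        exact ⟨h3.le, h4.le⟩
      have hbounds : ∀ s, μ₁ s * T s ≤ 1 / 2 ∧ μ₂ s * T s ≤ 1 / 2 → _ := fun s hs =>
        CHIP.general_sparse_bounds (hn' s) (hk' s) (hT s) (hpar s).mu₁_pos (hpar s).mu₂_pos (hμ s)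
          hs.1 hs.2
      have hG : ∀ s, _ := fun s => CHIP.general_bound_nonneg (k := k s) (μ₂ := μ₂ s) (hn' s) (hT s)
        (hpar s).mu₁_pos
      have hH : ∀ s, 0 ≤ n s * T s * μ₁ s /
          (((n s : ℝ) / k s) ^ 2 * (μ₁ s - μ₂ s) ^ 2 * T s ^ 2) := fun s => by
        have h3 := hT s
        have h4 := (hpar s).mu₁_pos
        have h5 := hn' s
        positivity
      refine ⟨?_, ⟨?_, ?_⟩, ?_⟩
      · filter_upwards [hsmall] with s hs
        refine (CHIP.spectral_clustering_error_bound hc₀ hr hε (hn s) (hT s) (hpar s) (hμ s)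
          (hdense s) (hchip s)).trans (measureReal_mono fun ω hω z hz => (hω z hz).trans ?_)
        calc _ ≤ CHIP.errorConst c₀ r ε K * (16 * _) :=
              mul_le_mul_of_nonneg_left (hbounds s hs).1 hE.le
          _ = _ := by ring
      · refine IsBigO.of_bound 16 (hsmall.mono fun s hs => ?_)
        rw [Real.norm_of_nonneg (hG s), Real.norm_of_nonneg (hH s)]
        exact (hbounds s hs).1
      · refine IsBigO.of_bound 2 (hsmall.mono fun s hs => ?_)
        rw [Real.norm_of_nonneg (hG s), Real.norm_of_nonneg (hH s)]
        exact (hbounds s hs).2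
      · refine EventuallyEq.isTheta (Eventually.of_forall fun s => ?_)
        exact CHIP.sparse_bound_eq' (hn' s).ne' (hk' s).ne' (hT s).ne' (hμ s)
  · intro ε C c₀ hε hC _ n k c hk hn hc ι F μ₁ μ₂ T hT _ _ hμ h₁ h₂
    have h := CHIP.tendsto_generalBound (c₀ := c₀) hε hC hk hn hc hT hμ h₁ h₂
    refine ⟨h, tendsto_const_nhds.congr' ?_⟩
    filter_upwards [h.eventually_ge_atTop 1] with s hs
    exact (min_eq_left hs).symm
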